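/- **Schemata.** A linear expression is an expression built from integer variables, $0$, $s$, $+$, $-$, taken modulo the laws of arithmetic. A constraint is a first-order formula of linear arithmetic over $\mathbb Z$ (comparisons $=,<,\le,\ge,>$). Patterns are built from $\top$, $\bot$ and indexed propositions $p_{e_1,\dots,e_k}$ ($p$ a symbol of arity $k$, $e_j$ linear expressions) with $\neg,\wedge,\vee$ and iterations $\bigwedge_{i\mid\delta}\pi$, $\bigvee_{i\mid\delta}\pi$, where the constraint $\delta$ (the domain) and $\pi$ may contain the bound variable $i$. Patterns are taken up to renaming of bound variables, and all substitutions and replacements avoid capture of variables. $\varepsilon$ is the neutral element of $\bigwedge$ (namely $\top$) resp. $\bigvee$ (namely $\bot$); $\sqcap$, $\sqcap'$ stand for $\wedge$ or $\vee$ and $\sqcap_{i\mid\delta}$, $\sqcap'_{i\mid\delta}$ for the corresponding iterations. A schema $S=\pi\wedge C$ consists of a pattern $\pi$ and a constraint $C=C_S$; its parameters are the variables free in $\pi$ or $C$. An interpretation $\mathcal I$ is an environment $\rho$ (a map from integer variables to $\mathbb Z$ that makes $C$ true) and a truth assignment to the propositional variables $p_{n_1,\dots,n_k}$, $n_j\in\mathbb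 Z$; it is a model of $S$ if the realization of $\pi$ under $\rho$ is true, where $\sqcap_{i\mid\delta}\pi$ is realized as the conjunction resp. disjunction of the instances of $\pi$ for all $i\in\mathbb Z$ that satisfy $\delta$. A literal occurs positively in a realization if the corresponding proposition has an occurrence of the corresponding polarity. A schema is well formed if every domain $\delta$ of an iteration over $i$ entails $e_1\le i\wedge i\le e_2$ for some linear expressions $e_1,e_2$ without $i$, and $C$ entails that every parameter is $\ge 0$. The *context* of a position in $S$ is the conjunction of $C_S$ and the domains of the iterations that enclose this position. **Tableaux.** Nodes are labelled with pairs $(S,\Lambda)$, $\Lambda$ a finite set of literals. A tableau is a tree generated by the rules of SchDP from a single node $(S,\emptyset)$, $S$ well formed. The extension rules apply to a leaf that has not been closed by the looping rule, and add one or two children: * *Propositional splitting*: $(S,\Lambda)$ gives $(S,\Lambda\cup\{a\})$ and $(S,\Lambda\cup\{\neg a\})$, if $a$ is an indexed proposition whose variables are parameters of $S$, one of the literals $a,\neg a$ occurs positively in the realization of $S$ under every environment of $S$, and neither occurs in the realization of $\bigwedge\Lambda$ under any environment of $C_S$. * *Constraint splitting*: $(S[\sqcap_{i\mid\delta}\pi],\Lambda)$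 gives $(S[\sqcap_{i\mid\delta}\pi]\wedge\exists i\,\delta,\Lambda)$ and $(S[\varepsilon]\wedge\forall i\,\neg\delta,\Lambda)$, if $C_S\wedge\forall i\,\neg\delta$ is satisfiable and the free variables of $\delta$ other than $i$ are parameters. * *Rewriting* of a subpattern of $S$ at some position: * Algebraic: $\neg\top\to\bot$, $\neg\bot\to\top$, $\pi\wedge\top\to\pi$, $\pi\wedge\bot\to\bot$, $\pi\vee\top\to\top$, $\pi\vee\bot\to\pi$, $\bigwedge_{i\mid\delta}\top\to\top$, $\bigvee_{i\mid\delta}\bot\to\bot$, $\pi\sqcap\pi\to\pi$; $\sqcap_{i\mid\delta}\pi\to\varepsilon$ if (context of the position) $\wedge\,\exists i\,\delta$ is unsatisfiable; $\sqcap_{i\mid\delta}\pi\to\pi$ if the context of the position entails $\exists i\,\delta$ and $\pi$ does not contain $i$. * Instantiation: $\sqcap_{i\mid\delta}\pi\to\pi[e/i]\sqcap\sqcap_{i\mid\delta\wedge i\ne e}\pi$, for any linear expression $e$ such that $C_S\Rightarrow\delta[e/i]$ is valid. * Emptiness: $\sqcap_{i\mid\delta}(\pi[\sqcap'_{i'\mid\delta'}\pi'])\to\bigl(\sqcap_{i\mid\delta\wedge\exists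 i'\delta'}\pi[\sqcap'_{i'\mid\delta'}\pi']\bigr)\sqcap\bigl(\sqcap_{i\mid\delta\wedge\forall i'\neg\delta'}\pi[\varepsilon']\bigr)$, where $\varepsilon'$ is the neutral element of $\sqcap'$, if (context of the inner iteration) $\wedge\,\forall i'\neg\delta'$ is satisfiable, $i$ is free in $\delta'$, and no variable free in $\delta'$, other than $i'$, is bound by an iteration strictly between the two. * Propositional simplification: $p_{e_1,\dots,e_k}\to\sqcap_{i\mid(e_1\ne f_1\vee\dots\vee e_k\ne f_k)\wedge i=0}\,p_{e_1,\dots,e_k}$ with $i$ fresh, where $\sqcap$ is $\bigwedge$ if $p_{f_1,\dots,f_k}\in\Lambda$ and $\bigvee$ if $\neg p_{f_1,\dots,f_k}\in\Lambda$, if (context of the position) $\wedge\,e_1=f_1\wedge\dots\wedge e_k=f_k$ is satisfiable. * *Interval rule*: for integers $k,l>0$ and $\lhd\in\{<,\le,\ge,>\}$, $(S[\sqcap_{i\mid\delta\wedge k i\lhd e_1\wedge l i\lhd e_2}\pi],\Lambda)$ (the domain read modulo associativity, commutativity and unit of $\wedge$) gives $(S[\sqcap_{i\mid\delta\wedge k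 i\lhd e_1}\pi]\wedge l e_1\lhd k e_2,\Lambda)$ and $(S[\sqcap_{i\mid\delta\wedge l i\lhd e_2}\pi]\wedge\neg(l e_1\lhd k e_2),\Lambda)$, if the free variables of $\delta$ other than $i$ and the variables of $e_1,e_2$ are parameters. The *looping rule* closes a leaf $\beta$ if there is a node $\alpha$ of the tableau such that, writing $\hat S_\nu$ for the schema of a node $\nu$ in conjunction with its literals, $\hat S_\beta$ and $\hat S_\alpha$ have the same parameters and for every model of $\hat S_\beta$ with environment $\rho$ there is a model of $\hat S_\alpha$ with an environment $\rho'$ such that $\rho'(n)<\rho(n)$ for some parameter $n$ and $\rho'(m)\le\rho(m)$ for all other parameters $m$. SchDP consists of the extension rules and the looping rule. A leaf is *closed* if it was closed by the looping rule, or the pattern of its schema is $\bot$, or its constraint is unsatisfiable. A leaf is *irreducible* if no rule of SchDP applies to it. A tableau is *satisfiable* if $\hat S_\nu$ has a model for some leaf $\nu$. A *derivation* is a sequence of tableaux $(T_i)_{i\in I}$, $I=\mathbb N$ or $I=\{0,\dots,N\}$, in which each $T_{i+1}$ is obtained from $T_i$ by applying one rule of SchDP on a leaf. It is *fair* if some $T_i$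 contains an irreducible leaf that is not closed, or for every $i\in I$ and every leaf $\nu$ of $T_i$ that is not closed there is $j\ge i$ such that the step from $T_j$ to $T_{j+1}$ applies a rule on $\nu$. **Theorem (Model completeness).** Let $T_0$ be a satisfiable tableau and let $(T_i)_{i\in I}$ be a fair derivation starting from $T_0$. Then there are $k\in I$ and a leaf of $T_k$ that is irreducible and not closed. -/

import Mathlib

/-!
Iterated propositional schemata and the tableau procedure SchDP.

Bound integer variables are represented by de Bruijn indices, so that schemata are taken up to
renaming of bound variables: at the top level of a schema the variable `n` is the parameter number
`n`; below `d` iterations or quantifiers the variables `0, …, d - 1` are the bound ones, innermost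
first, and `n + d` is the parameter number `n`.
-/

namespace SchDP

/-- The sequence `a, f 0, f 1, …`. -/
def scons {α : Type*} (a : α) (f : ℕ → α) : ℕ → α
  | 0 => a
  | n + 1 => f n

/-- Linear expressions modulo the laws of arithmetic: an integer constant and the (finitely many
nonzero) integer coefficients of the variables. -/
abbrev LinExpr : Type := ℤ × (ℕ →₀ ℤ)

namespace LinExpr

/-- The variable `n`, as an expression. -/
noncomputable def var (n : ℕ) : LinExpr := (0, Finsupp.single n 1)

/-- The value of an expression. -/
def eval (ρ : ℕ → ℤ) (e : LinExpr) : ℤ := e.1 + e.2.sum fun n a => a * ρ n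

/-- Application of a substitution. -/
noncomputable def subst (σ : ℕ → LinExpr) (e : LinExpr) : LinExpr :=
  (e.1, 0) + e.2.sum fun n a => a • σ n

/-- The variables that occur in an expression. -/
def vars (e : LinExpr) : Set ℕ := {n | e.2 n ≠ 0}

end LinExpr

/-- The substitution that moves an object below `d` further binders. -/
noncomputable def shift (d : ℕ) : ℕ → LinExpr := fun n => LinExpr.var (n + d)

/-- A substitution as it acts below one further binder. -/
noncomputable def lift (σ : ℕ → LinExpr) : ℕ → LinExpr :=
  scons (LinExpr.var 0) fun n => (σ n).subst (shift 1)

/-- The substitution that replaces the innermost bound variable by `e` and removes its binder. -/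
noncomputable def inst (e : LinExpr) : ℕ → LinExpr := scons e LinExpr.var

/-- Comparison symbols. -/
inductive Cmp
  | eq | lt | le | ge | gt

/-- The meaning of a comparison symbol. -/
def Cmp.Holds : Cmp → ℤ → ℤ → Prop
  | .eq, a, b => a = b
  | .lt, a, b => a < b
  | .le, a, b => a ≤ b
  | .ge, a, b => a ≥ b
  | .gt, a, b => a > b

/-- Linear constraints: first-order formulas of linear arithmetic over the integers. -/
inductive Constraint
  | tru
  | cmp (r : Cmp) (e f : LinExpr)
  | neg (c : Constraint)
  | and (c₁ c₂ : Constraint)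
  | or (c₁ c₂ : Constraint)
  | ex (c : Constraint)
  | all (c : Constraint)

namespace Constraint

/-- Truth of a constraint under a valuation. -/
def Holds : Constraint → (ℕ → ℤ) → Prop
  | tru, _ => True
  | cmp r e f, ρ => r.Holds (e.eval ρ) (f.eval ρ)
  | neg c, ρ => ¬ c.Holds ρ
  | and c₁ c₂, ρ => c₁.Holds ρ ∧ c₂.Holds ρ
  | or c₁ c₂, ρ => c₁.Holds ρ ∨ c₂.Holds ρ
  | ex c, ρ => ∃ i : ℤ, c.Holds (scons i ρ)
  | all c, ρ => ∀ i : ℤ, c.Holds (scons i ρ)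

/-- Application of a substitution. -/
noncomputable def subst : (ℕ → LinExpr) → Constraint → Constraint
  | _, tru => tru
  | σ, cmp r e f => cmp r (e.subst σ) (f.subst σ)
  | σ, neg c => neg (c.subst σ)
  | σ, and c₁ c₂ => and (c₁.subst σ) (c₂.subst σ)
  | σ, or c₁ c₂ => or (c₁.subst σ) (c₂.subst σ)
  | σ, ex c => ex (c.subst (lift σ))
  | σ, all c => all (c.subst (lift σ))

/-- The free variables. -/
def fv : Constraint → Set ℕ
  | tru => ∅
  | cmp _ e f => e.vars ∪ f.vars
  | neg c => c.fv
  | and c₁ c₂ => c₁.fv ∪ c₂.fv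
  | or c₁ c₂ => c₁.fv ∪ c₂.fv
  | ex c => {n | n + 1 ∈ c.fv}
  | all c => {n | n + 1 ∈ c.fv}

def Satisfiable (c : Constraint) : Prop := ∃ ρ : ℕ → ℤ, c.Holds ρ

/-- Validity of the implication from `c₁` to `c₂`. -/
def Entails (c₁ c₂ : Constraint) : Prop := ∀ ρ : ℕ → ℤ, c₁.Holds ρ → c₂.Holds ρ

/-- Conjunction of a list of constraints. -/
def conjAll : List Constraint → Constraint
  | [] => tru
  | c :: l => and c (conjAll l)

/-- Disjunction of a list of constraints. -/
def disjAll : List Constraint → Constraint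
  | [] => neg tru
  | c :: l => or c (disjAll l)

/-- The constraint `e₁ = f₁ ∧ … ∧ eₖ = fₖ`. -/
def allEq {k : ℕ} (e f : Fin k → LinExpr) : Constraint :=
  conjAll (List.ofFn fun j => cmp .eq (e j) (f j))

/-- The constraint `e₁ ≠ f₁ ∨ … ∨ eₖ ≠ fₖ`. -/
def someNe {k : ℕ} (e f : Fin k → LinExpr) : Constraint :=
  disjAll (List.ofFn fun j => neg (cmp .eq (e j) (f j)))

/-- The conjuncts of a constraint; two constraints have the same conjuncts iff they are equal up to
associativity, commutativity and unit of conjunction. -/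
def conjuncts : Constraint → Multiset Constraint
  | tru => 0
  | and c₁ c₂ => c₁.conjuncts + c₂.conjuncts
  | c => {c}

/-- The constraint `c` (a domain with bound variable `0`) encloses its bound variable: it entails
`e₁ ≤ i ∧ i ≤ e₂` for two expressions that do not contain this variable. -/
def Encloses (c : Constraint) : Prop :=
  ∃ e₁ e₂ : LinExpr, ∀ (ρ : ℕ → ℤ) (i : ℤ),
    c.Holds (scons i ρ) → e₁.eval ρ ≤ i ∧ i ≤ e₂.eval ρ

end Constraint

/-- The two connectives, conjunction and disjunction. -/
inductive Op
  | conj | disj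

universe u

/-- Indexed propositions: a symbol of some arity `k` with `k` indices. -/
abbrev Atom (P : ℕ → Type u) : Type u := Σ k : ℕ, P k × (Fin k → LinExpr)

/-- Propositional variables: a symbol of some arity `k` with `k` integers. -/
abbrev GroundAtom (P : ℕ → Type u) : Type u := Σ k : ℕ, P k × (Fin k → ℤ)

section

variable {P : ℕ → Type u}

namespace Atom

def eval (ρ : ℕ → ℤ) (a : Atom P) : GroundAtom P := ⟨a.1, a.2.1, fun j => (a.2.2 j).eval ρ⟩

noncomputable def subst (σ : ℕ → LinExpr) (a : Atom P) : Atom P :=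
  ⟨a.1, a.2.1, fun j => (a.2.2 j).subst σ⟩

def vars (a : Atom P) : Set ℕ := {n | ∃ j, n ∈ (a.2.2 j).vars}

end Atom

variable (P) in
/-- Formula patterns. In `iter o c π` the variable `0` is bound in the domain `c` and in the body
`π`. Negation may stand in front of any pattern, since the rules rewrite atoms below negations. -/
inductive Pattern : Type u
  | top
  | bot
  | atom (a : Atom P)
  | neg (π : Pattern)
  | bin (o : Op) (π₁ π₂ : Pattern)
  | iter (o : Op) (c : Constraint) (π : Pattern)

namespace Pattern

/-- The neutral element of a connective. -/
def neutral : Op → Pattern P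
  | .conj => top
  | .disj => bot

/-- Application of a substitution. -/
noncomputable def subst : (ℕ → LinExpr) → Pattern P → Pattern P
  | _, top => top
  | _, bot => bot
  | σ, atom a => atom (a.subst σ)
  | σ, neg π => neg (π.subst σ)
  | σ, bin o π₁ π₂ => bin o (π₁.subst σ) (π₂.subst σ)
  | σ, iter o c π => iter o (c.subst (lift σ)) (π.subst (lift σ))

/-- The free variables, that is, the parameters. -/
def fv : Pattern P → Set ℕ
  | top => ∅
  | bot => ∅
  | atom a => a.vars
  | neg π => π.fv
  | bin _ π₁ π₂ => π₁.fv ∪ π₂.fv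
  | iter _ c π => {n | n + 1 ∈ c.fv ∪ π.fv}

/-- Truth of the propositional realization of a pattern under the ground substitution `ρ` in the
propositional interpretation `I`. -/
def Holds (I : GroundAtom P → Prop) : Pattern P → (ℕ → ℤ) → Prop
  | top, _ => True
  | bot, _ => False
  | atom a, ρ => I (a.eval ρ)
  | neg π, ρ => ¬ π.Holds I ρ
  | bin .conj π₁ π₂, ρ => π₁.Holds I ρ ∧ π₂.Holds I ρ
  | bin .disj π₁ π₂, ρ => π₁.Holds I ρ ∨ π₂.Holds I ρ
  | iter .conj c π, ρ => ∀ i : ℤ, c.Holds (scons i ρ) → π.Holds I (scons i ρ)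
  | iter .disj c π, ρ => ∃ i : ℤ, c.Holds (scons i ρ) ∧ π.Holds I (scons i ρ)

/-- `π.Occurs g b ρ`: in the propositional realization of `π` under `ρ`, the propositional variable
`g` has an occurrence of positive polarity if `b = true` (so that the literal `g` occurs positively)
and one of negative polarity if `b = false` (so that the literal `¬ g` occurs positively). -/
def Occurs (g : GroundAtom P) : Pattern P → Bool → (ℕ → ℤ) → Prop
  | top, _, _ => False
  | bot, _, _ => False
  | atom a, b, ρ => b = true ∧ a.eval ρ = g
  | neg π, b, ρ => π.Occurs g (!b) ρ
  | bin _ π₁ π₂, b, ρ => π₁.Occurs g b ρ ∨ π₂.Occurs g b ρ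
  | iter _ c π, b, ρ => ∃ i : ℤ, c.Holds (scons i ρ) ∧ π.Occurs g b (scons i ρ)

/-- The domain of every iteration encloses its bound variable. -/
def AllEnclosed : Pattern P → Prop
  | top => True
  | bot => True
  | atom _ => True
  | neg π => π.AllEnclosed
  | bin _ π₁ π₂ => π₁.AllEnclosed ∧ π₂.AllEnclosed
  | iter _ c π => c.Encloses ∧ π.AllEnclosed

end Pattern

variable (P) in
/-- A schema: a pattern with a constraint. -/
structure Schema : Type u where
  pat : Pattern P
  cstr : Constraint

namespace Schema

/-- The parameters. -/
def params (S : Schema P) : Set ℕ := S.pat.fv ∪ S.cstr.fv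

/-- The interpretation that consists of the environment `ρ` and the propositional interpretation
`I` is a model of `S`. -/
def IsModel (S : Schema P) (ρ : ℕ → ℤ) (I : GroundAtom P → Prop) : Prop :=
  S.cstr.Holds ρ ∧ S.pat.Holds I ρ

/-- The standing assumptions: domains of iterations enclose their variables, and the constraint
entails that all parameters are nonnegative. -/
def WellFormed (S : Schema P) : Prop :=
  S.pat.AllEnclosed ∧ ∀ ρ : ℕ → ℤ, S.cstr.Holds ρ → ∀ n ∈ S.params, 0 ≤ ρ n

/-- The literal `a` (if `b = true`) or `¬ a` (if `b = false`) occurs positively in the realization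
of `S` under every environment. -/
def AlwaysOccurs (S : Schema P) (b : Bool) (a : Atom P) : Prop :=
  ∀ ρ : ℕ → ℤ, S.cstr.Holds ρ → S.pat.Occurs (a.eval ρ) b ρ

/-- The literal `a` (if `b = true`) or `¬ a` (if `b = false`) occurs positively in the realization
of `S` under some environment. -/
def MayOccur (S : Schema P) (b : Bool) (a : Atom P) : Prop :=
  ∃ ρ : ℕ → ℤ, S.cstr.Holds ρ ∧ S.pat.Occurs (a.eval ρ) b ρ

/-- `S₁` loops on `S₂`. -/
def LoopsOn (S₁ S₂ : Schema P) : Prop :=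
  S₁.params = S₂.params ∧
    ∀ (ρ : ℕ → ℤ) (I : GroundAtom P → Prop), S₁.IsModel ρ I →
      ∃ (ρ' : ℕ → ℤ) (I' : GroundAtom P → Prop), S₂.IsModel ρ' I' ∧
        ∃ n ∈ S₁.params, ρ' n < ρ n ∧ ∀ m ∈ S₁.params, m ≠ n → ρ' m ≤ ρ m

end Schema

/-- A literal `(true, a)` stands for `a`, a literal `(false, a)` for `¬ a`. -/
abbrev Literal (P : ℕ → Type u) : Type u := Bool × Atom P

def Literal.toPattern : Literal P → Pattern P
  | (true, a) => .atom a
  | (false, a) => .neg (.atom a)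

/-- The conjunction of a finite set of literals. -/
noncomputable def litsPattern (Λ : Finset (Literal P)) : Pattern P :=
  Λ.toList.foldr (fun L π => .bin .conj L.toPattern π) .top

/-! ### Positions -/

variable (P) in
/-- One step from a pattern to one of its immediate subpatterns. -/
inductive Frame : Type u
  | neg
  | binLeft (o : Op) (right : Pattern P)
  | binRight (o : Op) (left : Pattern P)
  | iter (o : Op) (c : Constraint)

def Frame.plug : Frame P → Pattern P → Pattern P
  | .neg, π => .neg π
  | .binLeft o right, π => .bin o π right
  | .binRight o left, π => .bin o left π
  | .iter o c, π => .iter o c π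

/-- A pattern with a hole, as the list of the steps from the hole up to the root. -/
abbrev Surround (P : ℕ → Type u) : Type u := List (Frame P)

namespace Surround

/-- The pattern obtained by filling the hole. -/
def plug : Surround P → Pattern P → Pattern P
  | [], π => π
  | F :: K, π => plug K (F.plug π)

/-- The number of iterations around the hole. -/
def depth : Surround P → ℕ
  | [] => 0
  | .iter _ _ :: K => depth K + 1
  | _ :: K => depth K

/-- The constraint context of the hole: the constraint `C` of the schema together with the domains
of all iterations around the hole. -/
noncomputable def context (C : Constraint) : Surround P → Constraint
  | [] => C
  | .iter _ c :: K => .and ((context C K).subst (shift 1)) c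
  | _ :: K => context C K

end Surround

/-! ### The rules -/

/-- `Rewrite C Λ K π π'`: in a node with constraint `C` and literals `Λ`, the subpattern `π` at the
position given by `K` may be rewritten to `π'`. -/
inductive Rewrite (C : Constraint) (Λ : Finset (Literal P)) (K : Surround P) :
    Pattern P → Pattern P → Prop
  -- algebraic simplification
  | neg_top : Rewrite C Λ K (.neg .top) .bot
  | neg_bot : Rewrite C Λ K (.neg .bot) .top
  | and_top (π : Pattern P) : Rewrite C Λ K (.bin .conj π .top) π
  | and_bot (π : Pattern P) : Rewrite C Λ K (.bin .conj π .bot) .bot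
  | or_top (π : Pattern P) : Rewrite C Λ K (.bin .disj π .top) .top
  | or_bot (π : Pattern P) : Rewrite C Λ K (.bin .disj π .bot) π
  | iter_neutral (o : Op) (c : Constraint) :
      Rewrite C Λ K (.iter o c (.neutral o)) (.neutral o)
  | idem (o : Op) (π : Pattern P) : Rewrite C Λ K (.bin o π π) π
  | iter_empty (o : Op) (c : Constraint) (π : Pattern P)
      (h : ¬ ((Surround.context C K).and (.ex c)).Satisfiable) :
      Rewrite C Λ K (.iter o c π) (.neutral o)
  | iter_unused (o : Op) (c : Constraint) (π : Pattern P)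
      (h : (Surround.context C K).Entails (.ex c)) :
      Rewrite C Λ K (.iter o c (π.subst (shift 1))) π
  -- instantiation
  | instantiation (o : Op) (c : Constraint) (π : Pattern P) (e : LinExpr)
      (h : (C.subst (shift K.depth)).Entails (c.subst (inst e))) :
      Rewrite C Λ K (.iter o c π)
        (.bin o (π.subst (inst e))
          (.iter o (c.and (.neg (.cmp .eq (.var 0) (e.subst (shift 1))))) π))
  -- emptiness; in `c'` the variable `0` is that of the inner iteration, `1` that of the outer one
  | emptiness (o o' : Op) (c c' : Constraint) (K' : Surround P) (π' : Pattern P)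
      (hfree : 1 ∈ c'.fv)
      (h : ((Surround.context C (K' ++ .iter o c :: K)).and
        ((Constraint.all (.neg c')).subst (shift K'.depth))).Satisfiable) :
      Rewrite C Λ K
        (.iter o c (K'.plug (.iter o' (c'.subst (lift (shift K'.depth))) π')))
        (.bin o
          (.iter o (c.and (.ex c')) (K'.plug (.iter o' (c'.subst (lift (shift K'.depth))) π')))
          (.iter o (c.and (.all (.neg c'))) (K'.plug (.neutral o'))))
  -- propositional simplification
  | prop_simpl (b : Bool) (k : ℕ) (p : P k) (e f : Fin k → LinExpr)
      (hmem : ((b, ⟨k, p, f⟩) : Literal P) ∈ Λ)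
      (h : ((Surround.context C K).and
        (.allEq e fun j => (f j).subst (shift K.depth))).Satisfiable) :
      Rewrite C Λ K (.atom ⟨k, p, e⟩)
        (.iter (if b then .conj else .disj)
          ((Constraint.someNe (fun j => (e j).subst (shift 1))
            fun j => (f j).subst (shift (K.depth + 1))).and (.cmp .eq (.var 0) 0))
          (.atom ⟨k, p, fun j => (e j).subst (shift 1)⟩))

variable (P) in
/-- The label of a node of a tableau: a schema and a finite set of literals. -/
structure Label : Type u where
  sch : Schema P
  lits : Finset (Literal P)

/-- The schema of the label in conjunction with its literals. -/
noncomputable def Label.full (l : Label P) : Schema P :=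
  ⟨.bin .conj l.sch.pat (litsPattern l.lits), l.sch.cstr⟩

open Classical in
/-- `Extension l ls`: an extension rule with premise `l` has the conclusions `ls`. -/
inductive Extension : Label P → List (Label P) → Prop
  | prop_split (S : Schema P) (Λ : Finset (Literal P)) (a : Atom P)
      (hparams : a.vars ⊆ S.params)
      (halways : S.AlwaysOccurs true a ∨ S.AlwaysOccurs false a)
      (hpos : ¬ Schema.MayOccur ⟨litsPattern Λ, S.cstr⟩ true a)
      (hneg : ¬ Schema.MayOccur ⟨litsPattern Λ, S.cstr⟩ false a) :
      Extension ⟨S, Λ⟩ [⟨S, insert (true, a) Λ⟩, ⟨S, insert (false, a) Λ⟩]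
  -- the free variables of the domain, other than its bound variable, are parameters
  | constraint_split (C : Constraint) (Λ : Finset (Literal P)) (K : Surround P) (o : Op)
      (c : Constraint) (π : Pattern P) (h : (C.and (.all (.neg c))).Satisfiable) :
      Extension ⟨⟨K.plug (.iter o (c.subst (lift (shift K.depth))) π), C⟩, Λ⟩
        [⟨⟨K.plug (.iter o (c.subst (lift (shift K.depth))) π), C.and (.ex c)⟩, Λ⟩,
          ⟨⟨K.plug (.neutral o), C.and (.all (.neg c))⟩, Λ⟩]
  | rewriting (C : Constraint) (Λ : Finset (Literal P)) (K : Surround P) (π π' : Pattern P)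
      (h : Rewrite C Λ K π π') :
      Extension ⟨⟨K.plug π, C⟩, Λ⟩ [⟨⟨K.plug π', C⟩, Λ⟩]
  -- `δ` is the domain `c ∧ k.i ◃ e₁ ∧ l.i ◃ e₂`, where the variables of `e₁` and `e₂`, and the free
  -- variables of `c` other than `i`, are parameters
  | intervalise (C : Constraint) (Λ : Finset (Literal P)) (K : Surround P) (o : Op)
      (δ c : Constraint) (π : Pattern P) (r : Cmp) (k l : ℕ) (e₁ e₂ : LinExpr)
      (hr : r ≠ .eq) (hk : 0 < k) (hl : 0 < l)
      (hδ : δ.conjuncts = (c.subst (lift (shift K.depth))).conjuncts +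
        {.cmp r (k • .var 0) (e₁.subst (shift (K.depth + 1))),
          .cmp r (l • .var 0) (e₂.subst (shift (K.depth + 1)))}) :
      Extension ⟨⟨K.plug (.iter o δ π), C⟩, Λ⟩
        [⟨⟨K.plug (.iter o ((c.subst (lift (shift K.depth))).and
              (.cmp r (k • .var 0) (e₁.subst (shift (K.depth + 1))))) π),
            C.and (.cmp r (l • e₁) (k • e₂))⟩, Λ⟩,
          ⟨⟨K.plug (.iter o ((c.subst (lift (shift K.depth))).and
              (.cmp r (l • .var 0) (e₂.subst (shift (K.depth + 1))))) π),
            C.and (.neg (.cmp r (l • e₁) (k • e₂)))⟩, Λ⟩]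

/-! ### Tableaux and derivations -/

variable (P) in
/-- A (binary) labelled tree. A node is given by its path, last step first: `[]` is the root, and the
possible children of `ν` are `false :: ν` and `true :: ν`. -/
structure Tableau : Type u where
  /-- The label of each node, `none` where there is no node. -/
  label : List Bool → Option (Label P)
  /-- The leaves that were closed by the looping rule. -/
  looped : Set (List Bool)

namespace Tableau

/-- The tableau with a single node, labelled with a schema and the empty set of literals. -/
def single (S : Schema P) : Tableau P where
  label
    | [] => some ⟨S, ∅⟩
    | _ :: _ => none
  looped := ∅

def IsLeaf (T : Tableau P) (ν : List Bool) : Prop :=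
  (T.label ν).isSome ∧ ∀ b, T.label (b :: ν) = none

/-- Add children with the labels `ls` (one or two) to the node `ν`. -/
def extend (T : Tableau P) (ν : List Bool) (ls : List (Label P)) : Tableau P where
  label
    | [] => T.label []
    | b :: μ => if μ = ν then ls[b.toNat]? else T.label (b :: μ)
  looped := T.looped

/-- The leaf `ν` is closed. -/
def IsClosed (T : Tableau P) (ν : List Bool) : Prop :=
  ν ∈ T.looped ∨
    ∃ l, T.label ν = some l ∧ (l.sch.pat = .bot ∨ ¬ l.sch.cstr.Satisfiable)

/-- `T'` is obtained from `T` by applying a rule of SchDP on the leaf `ν`. -/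
inductive StepAt (T : Tableau P) (ν : List Bool) : Tableau P → Prop
  | extension (l : Label P) (ls : List (Label P)) (hleaf : T.IsLeaf ν) (hloop : ν ∉ T.looped)
      (hl : T.label ν = some l) (h : Extension l ls) : StepAt T ν (T.extend ν ls)
  | looping (μ : List Bool) (l m : Label P) (hleaf : T.IsLeaf ν) (hloop : ν ∉ T.looped)
      (hl : T.label ν = some l) (hm : T.label μ = some m) (h : l.full.LoopsOn m.full) :
      StepAt T ν ⟨T.label, insert ν T.looped⟩

/-- `T'` is obtained from `T` by applying a rule of SchDP. -/
def Step (T T' : Tableau P) : Prop := ∃ ν, T.StepAt ν T'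

/-- `T` is generated by the rules of SchDP from a root schema. -/
def Generated (T : Tableau P) : Prop :=
  ∃ S : Schema P, S.WellFormed ∧ Relation.ReflTransGen Step (single S) T

/-- Some leaf of `T` has a model. -/
def Satisfiable (T : Tableau P) : Prop :=
  ∃ ν l, T.IsLeaf ν ∧ T.label ν = some l ∧ ∃ ρ I, l.full.IsModel ρ I

/-- No rule of SchDP applies on `ν`. -/
def Irreducible (T : Tableau P) (ν : List Bool) : Prop := ¬ ∃ T', T.StepAt ν T'

end Tableau

/-- `T 0, T 1, …` is a derivation whose set of indices is `{i | i ≤ N}`; it is infinite iff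
`N = ⊤`. -/
def IsDerivation (N : ℕ∞) (T : ℕ → Tableau P) : Prop :=
  ∀ i : ℕ, ((i + 1 : ℕ) : ℕ∞) ≤ N → (T i).Step (T (i + 1))

/-- Fairness: there is an irreducible leaf that is not closed, or no leaf that is not closed waits
forever. -/
def IsFair (N : ℕ∞) (T : ℕ → Tableau P) : Prop :=
  (∃ i : ℕ, (i : ℕ∞) ≤ N ∧ ∃ ν, (T i).IsLeaf ν ∧ (T i).Irreducible ν ∧ ¬ (T i).IsClosed ν) ∨
    ∀ i : ℕ, (i : ℕ∞) ≤ N → ∀ ν, (T i).IsLeaf ν → ¬ (T i).IsClosed ν →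
      ∃ j : ℕ, i ≤ j ∧ ((j + 1 : ℕ) : ℕ∞) ≤ N ∧ (T j).StepAt ν (T (j + 1))

end

end SchDP

namespace SchDP

variable {P : ℕ → Type*}

/-! The first alternative in the definition of fairness is already the conclusion, so it remains to
refute the second one for a satisfiable start: if every leaf that is not closed is eventually
treated, then no node has a model (`not_isModel_of_fair`).

Follow a model with environment `ρ` from node to node. Each extension rule passes it on unchanged to
some child (`Extension.exists_model`), and a well-founded measure, evaluated at this fixed `ρ`,
drops on the way. A leaf with a model has neither the pattern `⊥` nor an unsatisfiable constraint,
so the path can stop only at the looping rule. That rule supplies a model of some node with a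
smaller environment (`envSize_lt`): parameters are nonnegative, so their sum drops. An outer
induction on this sum and an inner one on the measure exclude all models.

The measure is lexicographic. First comes the number of propositional variables in the realization
under `ρ` that no literal decides. It is finite because all ranges are, propositional splitting
lowers it, and no other extension rule raises it. Second comes `Pattern.weight`, which every
extension rule except propositional splitting must lower. Its ingredients answer to the rules as
follows. Costs of iterations are exponential in the weights of their bodies, so that instantiation
and emptiness may copy bodies. An atom is weighed by the number of literals it can still meet in its
context, which propositional simplification lowers. Two flags record whether a domain can be empty:
one over the context, cleared by emptiness, one over the constraint alone, cleared by constraint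
splitting. A factor counts the inequalities in a domain, for the interval rule. The local drop is
`Rewrite.weight_lt` for rewriting and part of `Replacement` in general; `Pattern.weight_plug`
carries it to the root.

Comparing environments also requires control of the parameters. No rule leaves the parameters of the
root as long as the constraint is satisfiable (`NodeInv`); instantiation is the delicate case
(`Rewrite.vars_of_entails`). -/

/-! ### Valuations, substitutions and linear expressions -/

/-- The valuation below `d` binders, restricted to the variables that are free above them. -/
def drop (d : ℕ) (w : ℕ → ℤ) : ℕ → ℤ := fun n => w (n + d)

/-- The valuation that corresponds to a substitution under a given valuation. -/
def substVal (σ : ℕ → LinExpr) (w : ℕ → ℤ) : ℕ → ℤ := fun n => (σ n).eval w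

theorem drop_succ_scons (d : ℕ) (i : ℤ) (w : ℕ → ℤ) : drop (d + 1) (scons i w) = drop d w := rfl

theorem drop_one_scons (i : ℤ) (w : ℕ → ℤ) : drop 1 (scons i w) = w := rfl

theorem drop_one_drop (d : ℕ) (w : ℕ → ℤ) : drop d (drop 1 w) = drop (d + 1) w := rfl

theorem scons_drop_one (w : ℕ → ℤ) : scons (w 0) (drop 1 w) = w := by
  funext n
  cases n <;> rfl

theorem exists_drop_eq (d : ℕ) (ρ : ℕ → ℤ) : ∃ w, drop d w = ρ := by
  induction d generalizing ρ with
  | zero => exact ⟨ρ, rfl⟩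
  | succ d ih =>
    obtain ⟨w, hw⟩ := ih ρ
    exact ⟨scons 0 w, hw⟩

namespace LinExpr

/-- Evaluation of expressions as a homomorphism. -/
noncomputable def evalHom (ρ : ℕ → ℤ) : LinExpr →+ ℤ where
  toFun := eval ρ
  map_zero' := by simp [eval]
  map_add' e f := by
    simp only [eval, Prod.fst_add, Prod.snd_add]
    rw [Finsupp.sum_add_index' (by simp) (by intros; ring)]
    ring

theorem eval_eq_evalHom (ρ : ℕ → ℤ) (e : LinExpr) : e.eval ρ = evalHom ρ e := rfl

theorem eval_zero (ρ : ℕ → ℤ) : eval ρ 0 = 0 := map_zero (evalHom ρ)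

theorem eval_var (ρ : ℕ → ℤ) (n : ℕ) : (var n).eval ρ = ρ n := by
  simp [eval, var]

theorem eval_nsmul (ρ : ℕ → ℤ) (k : ℕ) (e : LinExpr) : (k • e).eval ρ = k * e.eval ρ := by
  rw [eval_eq_evalHom, map_nsmul, nsmul_eq_mul, ← eval_eq_evalHom]

theorem eval_subst (ρ : ℕ → ℤ) (σ : ℕ → LinExpr) (e : LinExpr) :
    (e.subst σ).eval ρ = e.eval (substVal σ ρ) := by
  rw [eval_eq_evalHom, subst, map_add, map_finsuppSum]
  simp only [map_zsmul, smul_eq_mul]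
  simp [← eval_eq_evalHom, eval, substVal]

theorem eval_congr {ρ ρ' : ℕ → ℤ} (e : LinExpr) (h : ∀ n ∈ e.vars, ρ n = ρ' n) :
    e.eval ρ = e.eval ρ' := by
  simp only [eval, Finsupp.sum]
  congr 1
  exact Finset.sum_congr rfl fun n hn => by rw [h n (by simpa [vars] using hn)]

/-- An expression is affine in each variable. With a nonzero coefficient it therefore takes
infinitely many values, which `Rewrite.vars_of_entails` plays against finite ranges. -/
theorem eval_update (ρ : ℕ → ℤ) (e : LinExpr) (n : ℕ) (x : ℤ) :
    e.eval (Function.update ρ n x) = e.eval ρ + e.2 n * (x - ρ n) := by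
  have h : ∀ ρ : ℕ → ℤ, e.eval ρ = e.1 + ((e.2.erase n).sum fun m a => a * ρ m) + e.2 n * ρ n := by
    intro ρ
    have h := congrArg (fun f => f.sum fun m a => a * ρ m) (Finsupp.single_add_erase n e.2)
    rw [Finsupp.sum_add_index' (by simp) (by intros; ring)] at h
    rw [eval, ← h]
    simp
    ring
  rw [h, h ρ]
  have h' : ((e.2.erase n).sum fun m a => a * Function.update ρ n x m) =
      (e.2.erase n).sum fun m a => a * ρ m := by
    refine Finsupp.sum_congr fun m hm => ?_
    rw [Function.update_of_ne]
    rintro rfl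
    simp at hm
  rw [h', Function.update_self]
  ring

theorem vars_var (n : ℕ) : (var n).vars = {n} := by
  ext m
  simp [vars, var, Finsupp.single_apply, eq_comm]

theorem vars_zero : vars 0 = ∅ := by
  ext
  simp [vars]

theorem vars_nsmul {k : ℕ} (hk : 0 < k) (e : LinExpr) : (k • e).vars = e.vars := by
  ext
  simp [vars, hk.ne']

theorem subst_snd_apply (σ : ℕ → LinExpr) (e : LinExpr) (m : ℕ) :
    (e.subst σ).2 m = e.2.sum fun n a => a * (σ n).2 m := by
  have h : ∀ f : LinExpr, f.2 m = ((Finsupp.applyAddHom m).comp (AddMonoidHom.snd ℤ (ℕ →₀ ℤ))) f :=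
    fun _ => rfl
  rw [h, subst, map_add, map_finsuppSum]
  simp

theorem vars_subst_subset (σ : ℕ → LinExpr) (e : LinExpr) {m : ℕ} (hm : m ∈ (e.subst σ).vars) :
    ∃ n ∈ e.vars, m ∈ (σ n).vars := by
  rw [vars, Set.mem_ofPred_eq, subst_snd_apply] at hm
  obtain ⟨n, hn, h⟩ := Finset.exists_ne_zero_of_sum_ne_zero hm
  exact ⟨n, by simpa [vars] using hn, right_ne_zero_of_mul h⟩

/-- A general substitution may cancel coefficients and so lose variables. Under an injective
renaming only `n` contributes to the coefficient of `r n`. -/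
theorem mem_vars_subst {σ : ℕ → LinExpr} {r : ℕ → ℕ} (hr : r.Injective)
    (hσ : ∀ n, σ n = var (r n)) {e : LinExpr} {n : ℕ} (hn : n ∈ e.vars) :
    r n ∈ (e.subst σ).vars := by
  rw [vars, Set.mem_ofPred_eq, subst_snd_apply, Finsupp.sum, Finset.sum_eq_single n]
  · simpa [hσ, var, vars] using hn
  · intro k _ hk
    simp [hσ, var, hr.ne hk]
  · intro h
    simp at h
    exact absurd h hn

end LinExpr

theorem substVal_lift (σ : ℕ → LinExpr) (i : ℤ) (w : ℕ → ℤ) :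
    substVal (lift σ) (scons i w) = scons i (substVal σ w) := by
  funext n
  cases n with
  | zero => exact LinExpr.eval_var _ _
  | succ n =>
    change ((σ n).subst (shift 1)).eval _ = (σ n).eval w
    rw [LinExpr.eval_subst]
    congr 1
    funext m
    exact LinExpr.eval_var _ _

theorem substVal_shift (d : ℕ) (w : ℕ → ℤ) : substVal (shift d) w = drop d w := by
  funext n
  exact LinExpr.eval_var _ _

theorem substVal_inst (e : LinExpr) (w : ℕ → ℤ) : substVal (inst e) w = scons (e.eval w) w := by
  funext n
  cases n with
  | zero => rfl
  | succ n => exact LinExpr.eval_var _ _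

theorem scons_congr {s : Set ℕ} {ρ ρ' : ℕ → ℤ} (i : ℤ) (h : ∀ n ∈ {n | n + 1 ∈ s}, ρ n = ρ' n) :
    ∀ n ∈ s, scons i ρ n = scons i ρ' n := by
  rintro (_ | n) hn
  · rfl
  · exact h n hn

/-- The action of a renaming of variables below one further binder. -/
def liftRename (r : ℕ → ℕ) : ℕ → ℕ
  | 0 => 0
  | n + 1 => r n + 1

theorem liftRename_injective {r : ℕ → ℕ} (hr : r.Injective) : (liftRename r).Injective := by
  rintro (_ | m) (_ | n) h <;> simp [liftRename] at h ⊢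
  exact hr h

theorem LinExpr.subst_var (σ : ℕ → LinExpr) (n : ℕ) : (var n).subst σ = σ n := by
  simp only [subst, var]
  rw [Finsupp.sum_single_index (by simp)]
  simp

theorem lift_rename {σ : ℕ → LinExpr} {r : ℕ → ℕ} (hσ : ∀ n, σ n = .var (r n)) (n : ℕ) :
    lift σ n = .var (liftRename r n) := by
  cases n with
  | zero => rfl
  | succ n =>
    change (σ n).subst (shift 1) = _
    rw [hσ, LinExpr.subst_var]
    rfl

theorem lift_vars {σ : ℕ → LinExpr} {n m : ℕ} (h : m + 1 ∈ (lift σ n).vars) :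
    ∃ k, n = k + 1 ∧ m ∈ (σ k).vars := by
  cases n with
  | zero => simp [lift, scons, LinExpr.vars_var] at h
  | succ n =>
    refine ⟨n, rfl, ?_⟩
    obtain ⟨k, hk, hm⟩ := LinExpr.vars_subst_subset _ _ h
    simp [shift, LinExpr.vars_var] at hm
    rwa [hm]

/-! ### Semantics, free variables and conjuncts of constraints -/

namespace Constraint

theorem holds_subst (σ : ℕ → LinExpr) (c : Constraint) (w : ℕ → ℤ) :
    (c.subst σ).Holds w ↔ c.Holds (substVal σ w) := by
  induction c generalizing σ w with
  | tru => rfl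
  | cmp r e f => simp only [subst, Holds, LinExpr.eval_subst]
  | neg c ih => simp only [subst, Holds, ih]
  | and c₁ c₂ ih₁ ih₂ => simp only [subst, Holds, ih₁, ih₂]
  | or c₁ c₂ ih₁ ih₂ => simp only [subst, Holds, ih₁, ih₂]
  | ex c ih => simp only [subst, Holds, ih, substVal_lift]
  | all c ih => simp only [subst, Holds, ih, substVal_lift]

theorem holds_congr (c : Constraint) {ρ ρ' : ℕ → ℤ} (h : ∀ n ∈ c.fv, ρ n = ρ' n) :
    c.Holds ρ ↔ c.Holds ρ' := by
  induction c generalizing ρ ρ' with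
  | tru => rfl
  | cmp r e f =>
    simp only [Holds, e.eval_congr fun n hn => h n (Or.inl hn),
      f.eval_congr fun n hn => h n (Or.inr hn)]
  | neg c ih => simp only [Holds, ih h]
  | and c₁ c₂ ih₁ ih₂ =>
    simp only [Holds, ih₁ fun n hn => h n (Or.inl hn), ih₂ fun n hn => h n (Or.inr hn)]
  | or c₁ c₂ ih₁ ih₂ =>
    simp only [Holds, ih₁ fun n hn => h n (Or.inl hn), ih₂ fun n hn => h n (Or.inr hn)]
  | ex c ih => exact exists_congr fun i => ih (scons_congr i h)
  | all c ih => exact forall_congr' fun i => ih (scons_congr i h)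

theorem fv_subst_subset (σ : ℕ → LinExpr) (c : Constraint) {m : ℕ} (hm : m ∈ (c.subst σ).fv) :
    ∃ n ∈ c.fv, m ∈ (σ n).vars := by
  have binder : ∀ (σ : ℕ → LinExpr) (s : Set ℕ) (m : ℕ), (∃ n ∈ s, m + 1 ∈ (lift σ n).vars) →
      ∃ n ∈ {n | n + 1 ∈ s}, m ∈ (σ n).vars := by
    rintro σ s m ⟨n, hn, h⟩
    obtain ⟨k, rfl, hk⟩ := lift_vars h
    exact ⟨k, hn, hk⟩
  induction c generalizing σ m with
  | tru => exact hm.elim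
  | cmp r e f =>
    rcases hm with hm | hm
    · obtain ⟨n, hn, h⟩ := LinExpr.vars_subst_subset _ _ hm
      exact ⟨n, Or.inl hn, h⟩
    · obtain ⟨n, hn, h⟩ := LinExpr.vars_subst_subset _ _ hm
      exact ⟨n, Or.inr hn, h⟩
  | neg c ih => exact ih _ hm
  | and c₁ c₂ ih₁ ih₂ | or c₁ c₂ ih₁ ih₂ =>
    rcases hm with hm | hm
    · obtain ⟨n, hn, h⟩ := ih₁ _ hm
      exact ⟨n, Or.inl hn, h⟩
    · obtain ⟨n, hn, h⟩ := ih₂ _ hm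
      exact ⟨n, Or.inr hn, h⟩
  | ex c ih | all c ih => exact binder _ _ _ (ih _ hm)

theorem mem_fv_subst {σ : ℕ → LinExpr} {r : ℕ → ℕ} (hr : r.Injective)
    (hσ : ∀ n, σ n = .var (r n)) (c : Constraint) {n : ℕ} (hn : n ∈ c.fv) :
    r n ∈ (c.subst σ).fv := by
  induction c generalizing σ r n with
  | tru => exact hn.elim
  | cmp _ e f => exact hn.imp (LinExpr.mem_vars_subst hr hσ) (LinExpr.mem_vars_subst hr hσ)
  | neg c ih => exact ih hr hσ hn
  | and c₁ c₂ ih₁ ih₂ | or c₁ c₂ ih₁ ih₂ => exact hn.imp (ih₁ hr hσ) (ih₂ hr hσ)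
  | ex c ih | all c ih => exact ih (liftRename_injective hr) (lift_rename hσ) hn

theorem holds_conjAll (l : List Constraint) (w : ℕ → ℤ) :
    (conjAll l).Holds w ↔ ∀ c ∈ l, c.Holds w := by
  induction l with
  | nil => simp [conjAll, Holds]
  | cons c l ih => simp [conjAll, Holds, ih]

theorem holds_disjAll (l : List Constraint) (w : ℕ → ℤ) :
    (disjAll l).Holds w ↔ ∃ c ∈ l, c.Holds w := by
  induction l with
  | nil => simp [disjAll, Holds]
  | cons c l ih => simp [disjAll, Holds, ih]

theorem fv_disjAll (l : List Constraint) {n : ℕ} : n ∈ (disjAll l).fv ↔ ∃ c ∈ l, n ∈ c.fv := by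
  induction l with
  | nil => simp [disjAll, fv]
  | cons c l ih => simp [disjAll, fv, ih]

theorem holds_allEq {k : ℕ} (e f : Fin k → LinExpr) (w : ℕ → ℤ) :
    (allEq e f).Holds w ↔ ∀ j, (e j).eval w = (f j).eval w := by
  simp [allEq, holds_conjAll, List.mem_ofFn, Holds, Cmp.Holds]

theorem holds_someNe {k : ℕ} (e f : Fin k → LinExpr) (w : ℕ → ℤ) :
    (someNe e f).Holds w ↔ ¬ ∀ j, (e j).eval w = (f j).eval w := by
  simp [someNe, holds_disjAll, List.mem_ofFn, Holds, Cmp.Holds]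

theorem fv_someNe {k : ℕ} (e f : Fin k → LinExpr) {n : ℕ} :
    n ∈ (someNe e f).fv ↔ ∃ j, n ∈ (e j).vars ∨ n ∈ (f j).vars := by
  simp [someNe, fv_disjAll, List.mem_ofFn, fv]

theorem holds_iff_conjuncts (c : Constraint) (w : ℕ → ℤ) :
    c.Holds w ↔ ∀ c' ∈ c.conjuncts, c'.Holds w := by
  induction c with
  | tru => simp [conjuncts, Holds]
  | and c₁ c₂ ih₁ ih₂ =>
    simp only [conjuncts, Holds, Multiset.mem_add, or_imp, forall_and, ih₁, ih₂]
  | _ => simp [conjuncts]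

theorem fv_iff_conjuncts (c : Constraint) {n : ℕ} :
    n ∈ c.fv ↔ ∃ c' ∈ c.conjuncts, n ∈ c'.fv := by
  induction c with
  | tru => simp [conjuncts, fv]
  | and c₁ c₂ ih₁ ih₂ =>
    simp only [conjuncts, fv, Set.mem_union, Multiset.mem_add, or_and_right, exists_or, ih₁, ih₂]
  | _ => simp [conjuncts]

/-- Being an inequality. -/
def IsIneq : Constraint → Prop
  | cmp r _ _ => r ≠ .eq
  | _ => False

open Classical in
/-- The number of conjuncts that are inequalities. -/
noncomputable def ineqs (c : Constraint) : ℕ := c.conjuncts.countP IsIneq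

theorem ineqs_and (c₁ c₂ : Constraint) : (c₁.and c₂).ineqs = c₁.ineqs + c₂.ineqs := by
  simp [ineqs, conjuncts]

theorem ineqs_subst (σ : ℕ → LinExpr) (c : Constraint) : (c.subst σ).ineqs = c.ineqs := by
  induction c with
  | and c₁ c₂ ih₁ ih₂ => simp only [subst, ineqs_and, ih₁, ih₂]
  | tru => rfl
  | cmp r e f => simp [ineqs, conjuncts, subst, ← Multiset.cons_zero, Multiset.countP_cons, IsIneq]; rfl
  | _ => simp [ineqs, conjuncts, subst, IsIneq, ← Multiset.cons_zero, Multiset.countP_cons]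

theorem ineqs_disjAll (l : List Constraint) : (disjAll l).ineqs = 0 := by
  cases l <;> simp [disjAll, ineqs, conjuncts, IsIneq, ← Multiset.cons_zero, Multiset.countP_cons]

end Constraint

theorem Atom.eval_subst (σ : ℕ → LinExpr) (a : Atom P) (w : ℕ → ℤ) :
    (a.subst σ).eval w = a.eval (substVal σ w) := by
  simp only [Atom.eval, Atom.subst, LinExpr.eval_subst]

/-! ### Finite ranges, substitution and occurrences in patterns -/

namespace Pattern

/-- Every iteration in the realization of the pattern has a finite range. -/
def FinDom : Pattern P → (ℕ → ℤ) → Prop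
  | top, _ => True
  | bot, _ => True
  | atom _, _ => True
  | neg π, w => π.FinDom w
  | bin _ π₁ π₂, w => π₁.FinDom w ∧ π₂.FinDom w
  | iter _ c π, w => {i : ℤ | c.Holds (scons i w)}.Finite ∧ ∀ i, π.FinDom (scons i w)

/-- The range lies in the interval between the two bounds. Finiteness is all that is used of
enclosure later, and it is this weaker property that is carried along the tableau. -/
theorem AllEnclosed.finDom {π : Pattern P} (h : π.AllEnclosed) (w : ℕ → ℤ) : π.FinDom w := by
  induction π generalizing w with
  | top | bot | atom a => trivial
  | neg π ih => exact ih h w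
  | bin o π₁ π₂ ih₁ ih₂ => exact ⟨ih₁ h.1 w, ih₂ h.2 w⟩
  | iter o c π ih =>
    obtain ⟨⟨e₁, e₂, hc⟩, hπ⟩ := h
    exact ⟨(Set.finite_Icc (e₁.eval w) (e₂.eval w)).subset fun i hi => hc w i hi,
      fun i => ih hπ _⟩

theorem finDom_neutral (o : Op) (w : ℕ → ℤ) : (neutral o : Pattern P).FinDom w := by
  cases o <;> trivial

theorem not_occurs_neutral (o : Op) (g : GroundAtom P) (b : Bool) (w : ℕ → ℤ) :
    ¬ (neutral o : Pattern P).Occurs g b w := by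
  cases o <;> exact id

theorem fv_neutral (o : Op) : (neutral o : Pattern P).fv = ∅ := by
  cases o <;> rfl

theorem holds_subst (I : GroundAtom P → Prop) (σ : ℕ → LinExpr) (π : Pattern P) (w : ℕ → ℤ) :
    (π.subst σ).Holds I w ↔ π.Holds I (substVal σ w) := by
  induction π generalizing σ w with
  | top | bot => rfl
  | atom a => simp only [subst, Holds, Atom.eval_subst]
  | neg π ih => simp only [subst, Holds, ih]
  | bin o π₁ π₂ ih₁ ih₂ => cases o <;> simp only [subst, Holds, ih₁, ih₂]
  | iter o c π ih =>
    cases o <;> simp only [subst, Holds, ih, Constraint.holds_subst, substVal_lift]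

theorem occurs_subst (g : GroundAtom P) (σ : ℕ → LinExpr) (π : Pattern P) (b : Bool)
    (w : ℕ → ℤ) : (π.subst σ).Occurs g b w ↔ π.Occurs g b (substVal σ w) := by
  induction π generalizing σ w b with
  | top | bot => rfl
  | atom a => simp only [subst, Occurs, Atom.eval_subst]
  | neg π ih => simp only [subst, Occurs, ih]
  | bin o π₁ π₂ ih₁ ih₂ => simp only [subst, Occurs, ih₁, ih₂]
  | iter o c π ih => simp only [subst, Occurs, ih, Constraint.holds_subst, substVal_lift]

theorem finDom_subst (σ : ℕ → LinExpr) (π : Pattern P) (w : ℕ → ℤ) :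
    (π.subst σ).FinDom w ↔ π.FinDom (substVal σ w) := by
  induction π generalizing σ w with
  | top | bot | atom => rfl
  | neg π ih => simp only [subst, FinDom, ih]
  | bin o π₁ π₂ ih₁ ih₂ => simp only [subst, FinDom, ih₁, ih₂]
  | iter o c π ih => simp only [subst, FinDom, ih, Constraint.holds_subst, substVal_lift]

theorem fv_subst_subset (σ : ℕ → LinExpr) (π : Pattern P) {m : ℕ} (hm : m ∈ (π.subst σ).fv) :
    ∃ n ∈ π.fv, m ∈ (σ n).vars := by
  induction π generalizing σ m with
  | top | bot => exact hm.elim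
  | atom a =>
    obtain ⟨j, hj⟩ := hm
    obtain ⟨n, hn, h⟩ := LinExpr.vars_subst_subset _ _ hj
    exact ⟨n, ⟨j, hn⟩, h⟩
  | neg π ih => exact ih _ hm
  | bin o π₁ π₂ ih₁ ih₂ =>
    rcases hm with hm | hm
    · obtain ⟨n, hn, h⟩ := ih₁ _ hm
      exact ⟨n, Or.inl hn, h⟩
    · obtain ⟨n, hn, h⟩ := ih₂ _ hm
      exact ⟨n, Or.inr hn, h⟩
  | iter o c π ih =>
    rcases hm with hm | hm
    · obtain ⟨n, hn, h⟩ := c.fv_subst_subset _ hm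
      obtain ⟨k, rfl, hk⟩ := lift_vars h
      exact ⟨k, Or.inl hn, hk⟩
    · obtain ⟨n, hn, h⟩ := ih _ hm
      obtain ⟨k, rfl, hk⟩ := lift_vars h
      exact ⟨k, Or.inr hn, hk⟩

theorem mem_fv_subst {σ : ℕ → LinExpr} {r : ℕ → ℕ} (hr : r.Injective)
    (hσ : ∀ n, σ n = .var (r n)) (π : Pattern P) {n : ℕ} (hn : n ∈ π.fv) :
    r n ∈ (π.subst σ).fv := by
  induction π generalizing σ r n with
  | top | bot => exact hn.elim
  | atom a =>
    obtain ⟨j, hj⟩ := hn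
    exact ⟨j, LinExpr.mem_vars_subst hr hσ hj⟩
  | neg π ih => exact ih hr hσ hn
  | bin o π₁ π₂ ih₁ ih₂ => exact hn.imp (ih₁ hr hσ) (ih₂ hr hσ)
  | iter o c π ih =>
    exact hn.imp (c.mem_fv_subst (liftRename_injective hr) (lift_rename hσ))
      (ih (liftRename_injective hr) (lift_rename hσ))

/-- Makes the first component of the measure a genuine cardinality: `Set.ncard` would be `0` on an
infinite set. -/
theorem FinDom.finite_occurs {π : Pattern P} {w : ℕ → ℤ} (h : π.FinDom w) :
    {g | ∃ b, π.Occurs g b w}.Finite := by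
  induction π generalizing w with
  | top | bot => simp [Occurs]
  | atom a => simp [Occurs]
  | neg π ih =>
    refine (ih h).subset ?_
    rintro g ⟨b, hb⟩
    exact ⟨_, hb⟩
  | bin o π₁ π₂ ih₁ ih₂ =>
    refine ((ih₁ h.1).union (ih₂ h.2)).subset ?_
    rintro g ⟨b, hb | hb⟩
    · exact Or.inl ⟨_, hb⟩
    · exact Or.inr ⟨_, hb⟩
  | iter o c π ih =>
    refine (h.1.biUnion fun i _ => ih (h.2 i)).subset ?_
    rintro g ⟨b, i, hi, hb⟩
    exact Set.mem_biUnion hi ⟨b, hb⟩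

end Pattern

/-! ### Conjunctions of literals -/

/-- Truth of a literal. -/
def Literal.Holds (I : GroundAtom P → Prop) (L : Literal P) (ρ : ℕ → ℤ) : Prop :=
  L.toPattern.Holds I ρ

theorem holds_litsPattern (I : GroundAtom P → Prop) (Λ : Finset (Literal P)) (ρ : ℕ → ℤ) :
    (litsPattern Λ).Holds I ρ ↔ ∀ L ∈ Λ, L.Holds I ρ := by
  have h (l : List (Literal P)) :
      (l.foldr (fun L π => Pattern.bin .conj L.toPattern π) .top).Holds I ρ ↔
        ∀ L ∈ l, L.Holds I ρ := by
    induction l with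
    | nil => simp [Pattern.Holds]
    | cons L l ih => simp [Pattern.Holds, ih, Literal.Holds]
  have h' := h Λ.toList
  simp only [Finset.mem_toList] at h'
  exact h'

theorem occurs_litsPattern (g : GroundAtom P) (b : Bool) (Λ : Finset (Literal P)) (ρ : ℕ → ℤ) :
    (litsPattern Λ).Occurs g b ρ ↔ ∃ a, (b, a) ∈ Λ ∧ a.eval ρ = g := by
  have h (l : List (Literal P)) :
      (l.foldr (fun L π => Pattern.bin .conj L.toPattern π) .top).Occurs g b ρ ↔
        ∃ a, (b, a) ∈ l ∧ a.eval ρ = g := by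
    induction l with
    | nil => simp [Pattern.Occurs]
    | cons L l ih =>
      simp only [List.foldr_cons, Pattern.Occurs, ih, List.mem_cons, or_and_right, exists_or]
      refine or_congr_left ?_
      obtain ⟨_ | _, a⟩ := L <;> cases b <;> simp [Literal.toPattern, Pattern.Occurs]
  have h' := h Λ.toList
  simp only [Finset.mem_toList] at h'
  exact h'

theorem fv_litsPattern (Λ : Finset (Literal P)) {n : ℕ} :
    n ∈ (litsPattern Λ).fv ↔ ∃ L ∈ Λ, n ∈ L.2.vars := by
  have h (l : List (Literal P)) :
      n ∈ (l.foldr (fun L π => Pattern.bin .conj L.toPattern π) .top).fv ↔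
        ∃ L ∈ l, n ∈ L.2.vars := by
    induction l with
    | nil => simp [Pattern.fv]
    | cons L l ih =>
      simp only [List.foldr_cons, Pattern.fv, Set.mem_union, ih, List.mem_cons, exists_eq_or_imp]
      refine or_congr_left ?_
      obtain ⟨_ | _, a⟩ := L <;> rfl
  have h' := h Λ.toList
  simp only [Finset.mem_toList] at h'
  exact h'

/-! ### Positions -/

namespace Surround

/-- The valuations of the variables at the hole that satisfy the domains around the hole and are in
`X` on the variables that are free outside. -/
def contextSet (X : Set (ℕ → ℤ)) : Surround P → Set (ℕ → ℤ)
  | [] => X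
  | .iter _ c :: K => {w | drop 1 w ∈ contextSet X K ∧ c.Holds w}
  | .neg :: K => contextSet X K
  | .binLeft _ _ :: K => contextSet X K
  | .binRight _ _ :: K => contextSet X K

theorem mem_contextSet (C : Constraint) (K : Surround P) (w : ℕ → ℤ) :
    w ∈ K.contextSet {ρ | C.Holds ρ} ↔ (K.context C).Holds w := by
  induction K generalizing w with
  | nil => rfl
  | cons F K ih =>
    cases F with
    | iter o c =>
      simp only [contextSet, context, Set.mem_ofPred_eq, ih, Constraint.Holds,
        Constraint.holds_subst, substVal_shift]
    | _ => exact ih w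

theorem contextSet_append (X : Set (ℕ → ℤ)) (K' K : Surround P) :
    contextSet X (K' ++ K) = contextSet (contextSet X K) K' := by
  induction K' with
  | nil => rfl
  | cons F K' ih => cases F <;> simp only [List.cons_append, contextSet, ih]

theorem drop_mem {X : Set (ℕ → ℤ)} {K : Surround P} {w : ℕ → ℤ} (h : w ∈ K.contextSet X) :
    drop K.depth w ∈ X := by
  induction K generalizing w with
  | nil => exact h
  | cons F K ih =>
    cases F with
    | iter o c => exact ih h.1
    | _ => exact ih h

theorem contextSet_mono {X Y : Set (ℕ → ℤ)} (h : X ⊆ Y) (K : Surround P) :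
    K.contextSet X ⊆ K.contextSet Y := by
  induction K with
  | nil => exact h
  | cons F K ih =>
    cases F with
    | iter o c => exact fun w hw => ⟨ih hw.1, hw.2⟩
    | _ => exact ih

theorem holds_plug {I : GroundAtom P → Prop} {X : Set (ℕ → ℤ)} (K : Surround P)
    {π π' : Pattern P} (h : ∀ w ∈ K.contextSet X, (π'.Holds I w ↔ π.Holds I w)) :
    ∀ ρ ∈ X, ((K.plug π').Holds I ρ ↔ (K.plug π).Holds I ρ) := by
  induction K generalizing π π' with
  | nil => exact h
  | cons F K ih =>
    refine ih fun w hw => ?_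
    cases F with
    | neg => exact not_congr (h w hw)
    | binLeft o r => cases o <;> simp only [Frame.plug, Pattern.Holds, h w hw]
    | binRight o r => cases o <;> simp only [Frame.plug, Pattern.Holds, h w hw]
    | iter o c =>
      have h' i (hi : c.Holds (scons i w)) := h (scons i w) ⟨hw, hi⟩
      cases o with
      | conj => exact forall₂_congr h'
      | disj => exact exists_congr fun i => and_congr_right (h' i)

/-- The hypothesis covers both polarities since negations around the hole exchange them. -/
theorem occurs_plug {g : GroundAtom P} {X : Set (ℕ → ℤ)} (K : Surround P)
    {π π' : Pattern P} (h : ∀ w ∈ K.contextSet X, ∀ b, π'.Occurs g b w → π.Occurs g b w) :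
    ∀ ρ ∈ X, ∀ b, (K.plug π').Occurs g b ρ → (K.plug π).Occurs g b ρ := by
  induction K generalizing π π' with
  | nil => exact h
  | cons F K ih =>
    refine ih fun w hw b => ?_
    cases F with
    | neg => exact h w hw _
    | binLeft o r => exact Or.imp_left (h w hw b)
    | binRight o r => exact Or.imp_right (h w hw b)
    | iter o c => exact fun ⟨i, hi, hb⟩ => ⟨i, hi, h (scons i w) ⟨hw, hi⟩ b hb⟩

/-- All valuations above `ρ` are needed, not only those in the context: `FinDom` speaks of every
value of a bound variable, even outside its domain. -/
theorem finDom_plug (K : Surround P) {π π' : Pattern P} {ρ : ℕ → ℤ}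
    (h : ∀ w, drop K.depth w = ρ → π.FinDom w → π'.FinDom w) (hπ : (K.plug π).FinDom ρ) :
    (K.plug π').FinDom ρ := by
  induction K generalizing π π' with
  | nil => exact h ρ rfl hπ
  | cons F K ih =>
    refine ih (fun w hw => ?_) hπ
    cases F with
    | neg => exact h w hw
    | binLeft o r => exact And.imp_left (h w hw)
    | binRight o r => exact And.imp_right (h w hw)
    | iter o c => exact And.imp_right fun h' i => h (scons i w) hw (h' i)

theorem finDom_of_plug (K : Surround P) {π : Pattern P} {ρ w : ℕ → ℤ}
    (hπ : (K.plug π).FinDom ρ) (hw : drop K.depth w = ρ) : π.FinDom w := by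
  induction K generalizing π w with
  | nil =>
    obtain rfl : w = ρ := hw
    exact hπ
  | cons F K ih =>
    cases F with
    | neg => exact (ih hπ hw :)
    | binLeft o r => exact (ih hπ hw).1
    | binRight o r => exact (ih hπ hw).2
    | iter o c =>
      have h := (ih (w := drop 1 w) hπ hw).2 (w 0)
      rwa [scons_drop_one] at h

theorem fv_plug (K : Surround P) {π π' : Pattern P} {X : Set ℕ}
    (h : ∀ n, n + K.depth ∈ π'.fv → n + K.depth ∈ π.fv ∨ n ∈ X) :
    (K.plug π').fv ⊆ (K.plug π).fv ∪ X := by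
  induction K generalizing π π' with
  | nil => exact h
  | cons F K ih =>
    refine ih fun n => ?_
    have h := h n
    cases F with
    | neg => exact h
    | binLeft o r =>
      rintro (hn | hn)
      · exact (h hn).imp_left Or.inl
      · exact Or.inl (Or.inr hn)
    | binRight o r =>
      rintro (hn | hn)
      · exact Or.inl (Or.inl hn)
      · exact (h hn).imp_left Or.inr
    | iter o c =>
      rintro (hn | hn)
      · exact Or.inl (Or.inl hn)
      · exact (h hn).imp_left Or.inr

theorem mem_fv_plug (K : Surround P) {π : Pattern P} {n : ℕ} (h : n + K.depth ∈ π.fv) :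
    n ∈ (K.plug π).fv := by
  induction K generalizing π with
  | nil => exact h
  | cons F K ih =>
    refine ih ?_
    cases F with
    | neg => exact h
    | binLeft o r => exact Or.inl h
    | binRight o r => exact Or.inr h
    | iter o c => exact Or.inr h

end Surround

/-! ### The weight of a pattern -/

open Classical in
/-- The sum of `f` over `s` if `s` is finite. -/
noncomputable def sumOver (s : Set ℤ) (f : ℤ → ℕ) : ℕ :=
  -- The default `0` keeps monotonicity and scaling true without a finiteness hypothesis.
  if h : s.Finite then ∑ i ∈ h.toFinset, f i else 0

theorem sumOver_of_finite {s : Set ℤ} (h : s.Finite) (f : ℤ → ℕ) :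
    sumOver s f = ∑ i ∈ h.toFinset, f i := dif_pos h

theorem sumOver_mono (s : Set ℤ) {f f' : ℤ → ℕ} (h : ∀ i, f i ≤ f' i) :
    sumOver s f ≤ sumOver s f' := by
  unfold sumOver
  split_ifs
  · exact Finset.sum_le_sum fun i _ => h i
  · rfl

theorem mul_sumOver (s : Set ℤ) (k : ℕ) (f : ℤ → ℕ) :
    k * sumOver s f = sumOver s fun i => k * f i := by
  unfold sumOver
  split_ifs
  · exact Finset.mul_sum _ _ _
  · rfl

theorem sumOver_remove {s : Set ℤ} (hs : s.Finite) {a : ℤ} (ha : a ∈ s) (f : ℤ → ℕ) :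
    f a + sumOver (s \ {a}) f = sumOver s f := by
  rw [sumOver_of_finite hs, sumOver_of_finite hs.sdiff,
    ← Finset.add_sum_erase _ _ (hs.mem_toFinset.2 ha)]
  congr 2
  ext i
  simp [and_comm]

theorem sumOver_split {s : Set ℤ} (hs : s.Finite) (p : ℤ → Prop) (f : ℤ → ℕ) :
    sumOver {i | i ∈ s ∧ p i} f + sumOver {i | i ∈ s ∧ ¬ p i} f = sumOver s f := by
  classical
  rw [sumOver_of_finite hs, sumOver_of_finite (hs.subset fun i hi => hi.1),
    sumOver_of_finite (hs.subset fun i hi => hi.1),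
    ← Finset.sum_filter_add_sum_filter_not hs.toFinset p]
  congr 2 <;> ext i <;> simp

/-- The cost of a body of cost `b i` for each value `i` of the bound variable, where the value `0`
is counted even if it is outside of the range `s`. -/
noncomputable def iterCost (s : Set ℤ) (b : ℤ → ℕ) : ℕ := 5 ^ b 0 + sumOver s fun i => 5 ^ b i

theorem iterCost_mono (s : Set ℤ) {b b' : ℤ → ℕ} (h : ∀ i, b i ≤ b' i) :
    iterCost s b ≤ iterCost s b' :=
  add_le_add (Nat.pow_le_pow_right (by norm_num) (h 0))
    (sumOver_mono s fun i => Nat.pow_le_pow_right (by norm_num) (h i))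

/-- Strictness comes from the extra summand at `0`, so a step inside the body is noticed even when
the range is empty. -/
theorem iterCost_strictMono (s : Set ℤ) {b b' : ℤ → ℕ} (h : ∀ i, b i < b' i) :
    iterCost s b < iterCost s b' :=
  add_lt_add_of_lt_of_le (Nat.pow_lt_pow_right (by norm_num) (h 0))
    (sumOver_mono s fun i => Nat.pow_le_pow_right (by norm_num) (h i).le)

theorem five_pow_le {m n : ℕ} (h : m < n) : 5 * 5 ^ m ≤ 5 ^ n := by
  rw [← pow_succ']
  exact Nat.pow_le_pow_right (by norm_num) h

/-- A drop by one in the body divides the cost by at least five; this pays for the two copies made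
by the emptiness rule. -/
theorem five_iterCost_le (s : Set ℤ) {b b' : ℤ → ℕ} (h : ∀ i, b i < b' i) :
    5 * iterCost s b ≤ iterCost s b' := by
  rw [iterCost, mul_add, mul_sumOver]
  exact add_le_add (five_pow_le (h 0)) (sumOver_mono s fun i => five_pow_le (h i))

theorem lt_iterCost (s : Set ℤ) (b : ℤ → ℕ) : b 0 < iterCost s b :=
  (Nat.lt_pow_self (by norm_num)).trans_le (Nat.le_add_right _ _)

open Classical in
/-- `1` if the constraint `c` on the bound variable has no solution under some valuation in `X`,
`0` otherwise. -/
noncomputable def emptyFlag (X : Set (ℕ → ℤ)) (c : Constraint) : ℕ :=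
  if ∃ w ∈ X, ∀ i, ¬ c.Holds (scons i w) then 1 else 0

theorem emptyFlag_le_one (X : Set (ℕ → ℤ)) (c : Constraint) : emptyFlag X c ≤ 1 := by
  unfold emptyFlag
  split_ifs <;> simp

theorem emptyFlag_le {X X' : Set (ℕ → ℤ)} {c c' : Constraint}
    (h : ∀ w ∈ X, (∀ i, ¬ c.Holds (scons i w)) → ∃ w' ∈ X', ∀ i, ¬ c'.Holds (scons i w')) :
    emptyFlag X c ≤ emptyFlag X' c' := by
  unfold emptyFlag
  split_ifs with h₁ h₂
  · rfl
  · obtain ⟨w, hw, hc⟩ := h₁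
    exact absurd (h w hw hc) h₂
  all_goals simp

theorem emptyFlag_mono {X X' : Set (ℕ → ℤ)} (h : X ⊆ X') (c : Constraint) :
    emptyFlag X c ≤ emptyFlag X' c :=
  emptyFlag_le fun w hw hc => ⟨w, h hw, hc⟩

theorem emptyFlag_eq_zero {X : Set (ℕ → ℤ)} {c : Constraint}
    (h : ∀ w ∈ X, ∃ i, c.Holds (scons i w)) : emptyFlag X c = 0 :=
  if_neg fun ⟨w, hw, hc⟩ => (h w hw).elim hc

theorem emptyFlag_eq_one {X : Set (ℕ → ℤ)} {c : Constraint}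
    (h : ∃ w ∈ X, ∀ i, ¬ c.Holds (scons i w)) : emptyFlag X c = 1 :=
  if_pos h

/-- The weight of an atom to which propositional simplification may still be applied with `r`
literals. -/
def atomWeight : ℕ → ℕ
  | 0 => 0
  -- Propositional simplification leaves an iteration with factor `4` and at most one value, hence
  -- cost at most `2 * 5 ^ atomWeight r` including the summand at `0`, and with two flags. The `3`
  -- exceeds the flags by one.
  | r + 1 => 8 * 5 ^ atomWeight r + 3

theorem atomWeight_mono : Monotone atomWeight := by
  refine monotone_nat_of_le_succ fun r => ?_
  have h : atomWeight r < 5 ^ atomWeight r := Nat.lt_pow_self (by norm_num)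
  simp only [atomWeight]
  omega

open Classical in
/-- The number of literals of `Λ` whose proposition coincides with the atom, which is below `d`
binders, under some valuation in `X`. -/
noncomputable def unifiable (Λ : Finset (Literal P)) (d : ℕ) (X : Set (ℕ → ℤ)) (a : Atom P) : ℕ :=
  (Λ.filter fun L => ∃ w ∈ X, a.eval w = L.2.eval (drop d w)).card

theorem unifiable_mono (Λ : Finset (Literal P)) (d : ℕ) {X X' : Set (ℕ → ℤ)} (h : X ⊆ X')
    (a : Atom P) : unifiable Λ d X a ≤ unifiable Λ d X' a := by
  refine Finset.card_le_card fun L hL => ?_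
  simp only [Finset.mem_filter] at hL ⊢
  obtain ⟨hL, w, hw, h'⟩ := hL
  exact ⟨hL, w, h hw, h'⟩

/-- The preimage of a set of valuations below one further binder. -/
def under (Y : Set (ℕ → ℤ)) : Set (ℕ → ℤ) := {w | drop 1 w ∈ Y}

/-- The valuations below a binder with domain `c`. -/
def underDom (X : Set (ℕ → ℤ)) (c : Constraint) : Set (ℕ → ℤ) := {w | drop 1 w ∈ X ∧ c.Holds w}

theorem under_mono {Y Y' : Set (ℕ → ℤ)} (h : Y ⊆ Y') : under Y ⊆ under Y' := fun _ hw => h hw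

theorem underDom_mono {X X' : Set (ℕ → ℤ)} (h : X ⊆ X') (c : Constraint) :
    underDom X c ⊆ underDom X' c := fun _ hw => ⟨h hw.1, hw.2⟩

/-- The range of an iteration under a valuation. -/
def range (c : Constraint) (w : ℕ → ℤ) : Set ℤ := {i | c.Holds (scons i w)}

namespace Pattern

/-- The weight of a pattern that is below `d` binders, under a valuation; here `Y` and `X` consist
of the valuations that satisfy the constraint of the schema and the context of the position. -/
noncomputable def weight (Λ : Finset (Literal P)) :
    Pattern P → ℕ → Set (ℕ → ℤ) → Set (ℕ → ℤ) → (ℕ → ℤ) → ℕ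
  | top, _, _, _, _ => 0
  | bot, _, _, _, _ => 0
  | atom a, d, _, X, _ => atomWeight (unifiable Λ d X a)
  | neg π, d, Y, X, w => π.weight Λ d Y X w + 1
  | bin _ π₁ π₂, d, Y, X, w => π₁.weight Λ d Y X w + π₂.weight Λ d Y X w + 1
  | iter _ c π, d, Y, X, w =>
    (4 + c.ineqs) * iterCost (range c w)
        (fun i => π.weight Λ (d + 1) (under Y) (underDom X c) (scons i w)) +
      emptyFlag X c + emptyFlag Y c

variable (Λ : Finset (Literal P))

theorem weight_neutral (o : Op) (d : ℕ) (Y X : Set (ℕ → ℤ)) (w : ℕ → ℤ) :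
    (neutral o : Pattern P).weight Λ d Y X w = 0 := by
  cases o <;> rfl

/-- With fewer admissible valuations an atom meets fewer literals and fewer domains can be empty.
Hence a stronger constraint or context never raises the weight of untouched parts. -/
theorem weight_mono (π : Pattern P) (d : ℕ) {Y Y' X X' : Set (ℕ → ℤ)} (hY : Y ⊆ Y')
    (hX : X ⊆ X') (w : ℕ → ℤ) : π.weight Λ d Y X w ≤ π.weight Λ d Y' X' w := by
  induction π generalizing d Y Y' X X' w with
  | top | bot => rfl
  | atom a => exact atomWeight_mono (unifiable_mono Λ d hX a)
  | neg π ih => exact Nat.succ_le_succ (ih d hY hX w)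
  | bin o π₁ π₂ ih₁ ih₂ =>
    exact Nat.succ_le_succ (add_le_add (ih₁ d hY hX w) (ih₂ d hY hX w))
  | iter o c π ih =>
    refine add_le_add (add_le_add (Nat.mul_le_mul_left _ (iterCost_mono _ fun i => ?_))
      (emptyFlag_mono hX c)) (emptyFlag_mono hY c)
    exact ih _ (under_mono hY) (underDom_mono hX c) _

theorem substVal_lift' (σ : ℕ → LinExpr) (w : ℕ → ℤ) :
    substVal (lift σ) w = scons (w 0) (substVal σ (drop 1 w)) := by
  rw [← substVal_lift, scons_drop_one]

theorem image_under (σ : ℕ → LinExpr) (Y : Set (ℕ → ℤ)) :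
    substVal (lift σ) '' under Y = under (substVal σ '' Y) := by
  ext u
  constructor
  · rintro ⟨w, hw, rfl⟩
    exact ⟨_, hw, by rw [substVal_lift', drop_one_scons]⟩
  · rintro ⟨w, hw, h⟩
    exact ⟨scons (u 0) w, hw, by rw [substVal_lift, h, scons_drop_one]⟩

theorem image_underDom (σ : ℕ → LinExpr) (X : Set (ℕ → ℤ)) (c : Constraint) :
    substVal (lift σ) '' underDom X (c.subst (lift σ)) = underDom (substVal σ '' X) c := by
  ext u
  constructor
  · rintro ⟨w, hw, rfl⟩
    exact ⟨⟨_, hw.1, by rw [substVal_lift', drop_one_scons]⟩, (c.holds_subst _ _).1 hw.2⟩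
  · rintro ⟨⟨w, hw, h⟩, hc⟩
    have hu : substVal (lift σ) (scons (u 0) w) = u := by rw [substVal_lift, h, scons_drop_one]
    exact ⟨scons (u 0) w, ⟨hw, (c.holds_subst _ _).2 (hu.symm ▸ hc)⟩, hu⟩

theorem emptyFlag_subst (σ : ℕ → LinExpr) (X : Set (ℕ → ℤ)) (c : Constraint) :
    emptyFlag X (c.subst (lift σ)) = emptyFlag (substVal σ '' X) c := by
  apply le_antisymm
  · refine emptyFlag_le fun w hw hc => ⟨_, ⟨w, hw, rfl⟩, fun i => ?_⟩
    rw [← substVal_lift, ← Constraint.holds_subst]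
    exact hc i
  · refine emptyFlag_le ?_
    rintro _ ⟨w, hw, rfl⟩ hc
    refine ⟨w, hw, fun i => ?_⟩
    rw [Constraint.holds_subst, substVal_lift]
    exact hc i

/-- Everything in the weight is semantic except `ineqs`, which substitution preserves. The condition
`hd` says that `σ` leaves the parameters alone, so the literals keep their values. -/
theorem weight_subst {σ : ℕ → LinExpr} {d d' : ℕ}
    (hd : ∀ w, drop d' (substVal σ w) = drop d w) (π : Pattern P) (Y X : Set (ℕ → ℤ))
    (w : ℕ → ℤ) : (π.subst σ).weight Λ d Y X w =
      π.weight Λ d' (substVal σ '' Y) (substVal σ '' X) (substVal σ w) := by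
  induction π generalizing σ d d' Y X w with
  | top | bot => rfl
  | atom a =>
    classical
    refine congrArg (fun s => atomWeight (Finset.card s)) (Finset.filter_congr fun L _ => ?_)
    simp only [Set.exists_mem_image, Atom.eval_subst, hd]
  | neg π ih => simp only [subst, weight, ih hd]
  | bin o π₁ π₂ ih₁ ih₂ => simp only [subst, weight, ih₁ hd, ih₂ hd]
  | iter o c π ih =>
    have hd' w : drop (d' + 1) (substVal (lift σ) w) = drop (d + 1) w := by
      rw [substVal_lift', drop_succ_scons, hd, drop_one_drop]
    simp only [subst, weight, Constraint.ineqs_subst, emptyFlag_subst, ih hd', image_under,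
      image_underDom, substVal_lift, range, Constraint.holds_subst]

theorem weight_iter_lt {o : Op} {c : Constraint} {π π' : Pattern P} {d : ℕ}
    {Y Y' X X' : Set (ℕ → ℤ)} (hY : Y' ⊆ Y) (hX : X' ⊆ X) {w : ℕ → ℤ}
    (h : ∀ i, π'.weight Λ (d + 1) (under Y') (underDom X' c) (scons i w) <
      π.weight Λ (d + 1) (under Y) (underDom X c) (scons i w)) :
    (iter o c π').weight Λ d Y' X' w < (iter o c π).weight Λ d Y X w :=
  add_lt_add_of_lt_of_le (add_lt_add_of_lt_of_le
    (Nat.mul_lt_mul_of_pos_left (iterCost_strictMono _ h) (by omega))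
      (emptyFlag_mono hX c)) (emptyFlag_mono hY c)

/-- Each frame is strictly monotone in the hole, and shrinking sets do not hurt its other parts. The
local drop is required at all valuations above `ρ`, because the weight also looks at the value `0`
outside of ranges. -/
theorem weight_plug {π π' : Pattern P} {d : ℕ} {Y Y' X X' : Set (ℕ → ℤ)} (hY : Y' ⊆ Y)
    (hX : X' ⊆ X) {ρ : ℕ → ℤ} (K : Surround P)
    (h : ∀ w, drop K.depth w = ρ →
      π'.weight Λ (d + K.depth) {u | drop K.depth u ∈ Y'} (K.contextSet X') w <
        π.weight Λ (d + K.depth) {u | drop K.depth u ∈ Y} (K.contextSet X) w) :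
    (K.plug π').weight Λ d Y' X' ρ < (K.plug π).weight Λ d Y X ρ := by
  induction K generalizing π π' with
  | nil => exact h ρ rfl
  | cons F K ih =>
    have hY' : {u | drop (Surround.depth K) u ∈ Y'} ⊆ {u | drop (Surround.depth K) u ∈ Y} :=
      fun u hu => hY hu
    have hX' := Surround.contextSet_mono hX K
    refine ih fun w hw => ?_
    cases F with
    | neg => exact Nat.succ_lt_succ (h w hw)
    | binLeft o r =>
      exact Nat.succ_lt_succ (add_lt_add_of_lt_of_le (h w hw) (weight_mono Λ r _ hY' hX' w))
    | binRight o r =>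
      exact Nat.succ_lt_succ (add_lt_add_of_le_of_lt (weight_mono Λ r _ hY' hX' w) (h w hw))
    | iter o c => exact weight_iter_lt Λ hY' hX' fun i => h (scons i w) hw

end Pattern

/-! ### Rewriting -/

theorem mem_context_of_mem_contextSet {C : Constraint} {K : Surround P} {ρ w : ℕ → ℤ}
    (hρ : C.Holds ρ) (hw : w ∈ K.contextSet {ρ}) :
    drop K.depth w = ρ ∧ (K.context C).Holds w :=
  ⟨Surround.drop_mem hw, (Surround.mem_contextSet C K w).1
    (Surround.contextSet_mono (by simpa using hρ) K hw)⟩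

theorem holds_lift_shift (c : Constraint) (d : ℕ) (i : ℤ) (w : ℕ → ℤ) :
    (c.subst (lift (shift d))).Holds (scons i w) ↔ c.Holds (scons i (drop d w)) := by
  rw [Constraint.holds_subst, substVal_lift, substVal_shift]

theorem holds_neutral_iff {I : GroundAtom P → Prop} (o : Op) {c : Constraint} {π : Pattern P}
    {w : ℕ → ℤ} (h : ∀ i, ¬ c.Holds (scons i w)) :
    (Pattern.neutral o).Holds I w ↔ (Pattern.iter o c π).Holds I w := by
  cases o with
  | conj => exact ⟨fun _ i hi => absurd hi (h i), fun _ => trivial⟩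
  | disj => exact ⟨False.elim, fun ⟨i, hi, _⟩ => h i hi⟩

theorem holds_plug_neutral {I : GroundAtom P → Prop} (K : Surround P) (o : Op) {c : Constraint}
    {π : Pattern P} {w : ℕ → ℤ} (h : ∀ i, ¬ c.Holds (scons i w)) :
    (K.plug (.neutral o)).Holds I w ↔
      (K.plug (.iter o (c.subst (lift (shift K.depth))) π)).Holds I w := by
  refine K.holds_plug (X := {w}) (fun u hu => holds_neutral_iff o fun i => ?_) w rfl
  rw [holds_lift_shift, show drop K.depth u = w from Surround.drop_mem hu]
  exact h i

theorem occurs_plug_neutral {g : GroundAtom P} (K : Surround P) (o : Op) {π : Pattern P} {b : Bool}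
    {w : ℕ → ℤ} (h : (K.plug (.neutral o)).Occurs g b w) : (K.plug π).Occurs g b w :=
  K.occurs_plug (X := Set.univ) (fun _ _ _ h => absurd h (Pattern.not_occurs_neutral o _ _ _)) w
    trivial b h

theorem finDom_plug_neutral (K : Surround P) (o : Op) {π : Pattern P} {w : ℕ → ℤ}
    (h : (K.plug π).FinDom w) : (K.plug (.neutral o)).FinDom w :=
  K.finDom_plug (fun _ _ _ => Pattern.finDom_neutral o _) h

theorem fv_plug_neutral (K : Surround P) (o : Op) (π : Pattern P) :
    (K.plug (.neutral o)).fv ⊆ (K.plug π).fv := by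
  have h := K.fv_plug (π := π) (π' := .neutral o) (X := ∅) fun n hn => by
    rw [Pattern.fv_neutral] at hn
    exact hn.elim
  rwa [Set.union_empty] at h

namespace Rewrite

variable {C : Constraint} {Λ : Finset (Literal P)} {K : Surround P} {π π' : Pattern P}

theorem eval_lit {k : ℕ} (p : P k) (f : Fin k → LinExpr) {d : ℕ} {w ρ : ℕ → ℤ}
    (hw : drop d w = ρ) :
    (⟨k, p, fun j => ((f j).subst (shift d)).eval w⟩ : GroundAtom P) =
      Atom.eval ρ (⟨k, p, f⟩ : Atom P) := by
  simp only [LinExpr.eval_subst, substVal_shift, hw, Atom.eval]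

theorem holds_iff (h : Rewrite C Λ K π π') {I : GroundAtom P → Prop} {ρ w : ℕ → ℤ}
    (hρ : C.Holds ρ) (hΛ : ∀ L ∈ Λ, L.Holds I ρ) (hw : w ∈ K.contextSet {ρ}) :
    π'.Holds I w ↔ π.Holds I w := by
  obtain ⟨hd, hctx⟩ := mem_context_of_mem_contextSet hρ hw
  cases h with
  | neg_top | neg_bot | and_top | and_bot | or_top | or_bot => simp [Pattern.Holds]
  | iter_neutral o c => cases o <;> simp [Pattern.neutral, Pattern.Holds]
  | idem o => cases o <;> simp [Pattern.Holds]
  | iter_empty o c π h => exact holds_neutral_iff o fun i hi => h ⟨w, hctx, i, hi⟩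
  | iter_unused o c _ h =>
    obtain ⟨i, hi⟩ := h w hctx
    cases o <;> simp only [Pattern.Holds, Pattern.holds_subst, substVal_shift, drop_one_scons]
    · exact ⟨fun h _ _ => h, fun h => h i hi⟩
    · exact ⟨fun h => ⟨i, hi, h⟩, fun ⟨_, _, h⟩ => h⟩
  | instantiation o c π e h =>
    have he : c.Holds (scons (e.eval w) w) := by
      rw [← substVal_inst, ← Constraint.holds_subst]
      refine h w ?_
      rwa [Constraint.holds_subst, substVal_shift, hd]
    have hne (i : ℤ) : (Constraint.neg (.cmp .eq (.var 0) (e.subst (shift 1)))).Holds (scons i w) ↔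
        i ≠ e.eval w := by
      simp only [Constraint.Holds, Cmp.Holds, LinExpr.eval_var, LinExpr.eval_subst, substVal_shift,
        drop_one_scons]
      rfl
    cases o with
    | conj =>
      simp only [Pattern.Holds, Pattern.holds_subst, substVal_inst, Constraint.Holds.eq_4, hne]
      refine ⟨fun ⟨h₀, h₁⟩ i hi => ?_, fun h => ⟨h _ he, fun i hi => h i hi.1⟩⟩
      by_cases hie : i = e.eval w
      · exact hie ▸ h₀
      · exact h₁ i ⟨hi, hie⟩
    | disj =>
      simp only [Pattern.Holds, Pattern.holds_subst, substVal_inst, Constraint.Holds.eq_4, hne]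
      constructor
      · rintro (h₀ | ⟨i, hi, h₁⟩)
        · exact ⟨_, he, h₀⟩
        · exact ⟨i, hi.1, h₁⟩
      · rintro ⟨i, hi, h₁⟩
        by_cases hie : i = e.eval w
        · exact Or.inl (hie ▸ h₁)
        · exact Or.inr ⟨i, ⟨hi, hie⟩, h₁⟩
  | emptiness o o' c c' K' π₀ _ _ =>
    have hi (i : ℤ) (h : ∀ j, ¬ c'.Holds (scons j (scons i w))) :=
      holds_plug_neutral (I := I) K' o' (π := π₀) h
    cases o with
    | conj =>
      simp only [Pattern.Holds, Constraint.Holds]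
      refine ⟨fun ⟨h₀, h₁⟩ i hc => ?_, fun h => ⟨fun i hc => h i hc.1,
        fun i hc => (hi i hc.2).2 (h i hc.1)⟩⟩
      by_cases hj : ∃ j, c'.Holds (scons j (scons i w))
      · exact h₀ i ⟨hc, hj⟩
      · rw [not_exists] at hj
        exact (hi i hj).1 (h₁ i ⟨hc, hj⟩)
    | disj =>
      simp only [Pattern.Holds, Constraint.Holds]
      constructor
      · rintro (⟨i, hc, h⟩ | ⟨i, hc, h⟩)
        · exact ⟨i, hc.1, h⟩
        · exact ⟨i, hc.1, (hi i hc.2).1 h⟩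
      · rintro ⟨i, hc, h⟩
        by_cases hj : ∃ j, c'.Holds (scons j (scons i w))
        · exact Or.inl ⟨i, ⟨hc, hj⟩, h⟩
        · rw [not_exists] at hj
          exact Or.inr ⟨i, ⟨hc, hj⟩, (hi i hj).2 h⟩
  | prop_simpl b k p e f hmem _ =>
    have hlit := hΛ _ hmem
    -- If the indices agree, the new domain is empty and the neutral element has the truth value
    -- dictated by the literal; otherwise the range is `{0}` and the atom itself remains.
    have heval : Atom.eval w (⟨k, p, e⟩ : Atom P) = Atom.eval ρ (⟨k, p, f⟩ : Atom P) ∨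
        ¬ ∀ j, (e j).eval w = ((f j).subst (shift K.depth)).eval w := by
      by_cases h : ∀ j, (e j).eval w = ((f j).subst (shift K.depth)).eval w
      · refine Or.inl ?_
        rw [← eval_lit p f hd]
        simp only [Atom.eval, h]
      · exact Or.inr h
    have hsub (i : ℤ) (j : Fin k) : ((f j).subst (shift (K.depth + 1))).eval (scons i w) =
        ((f j).subst (shift K.depth)).eval w := by
      simp only [LinExpr.eval_subst, substVal_shift, drop_succ_scons]
    cases b <;>
    · simp only [Pattern.Holds, Constraint.Holds, Constraint.holds_someNe, Cmp.Holds, Atom.eval,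
        LinExpr.eval_subst _ (shift 1), substVal_shift, drop_one_scons, hsub, LinExpr.eval_var,
        LinExpr.eval_zero, scons, if_true, Bool.false_eq_true, if_false]
      simp only [Literal.Holds, Literal.toPattern, Pattern.Holds] at hlit
      rcases heval with h | h
      · rw [← h] at hlit
        simp only [Atom.eval] at hlit
        simp [hlit]
      · simp [h]

theorem occurs (h : Rewrite C Λ K π π') {g : GroundAtom P} {b : Bool} {ρ w : ℕ → ℤ}
    (hρ : C.Holds ρ) (hw : w ∈ K.contextSet {ρ}) (hb : π'.Occurs g b w) : π.Occurs g b w := by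
  obtain ⟨hd, hctx⟩ := mem_context_of_mem_contextSet hρ hw
  cases h with
  | neg_top | neg_bot | and_bot | or_top => exact hb.elim
  | and_top | or_bot | idem => exact Or.inl hb
  | iter_neutral o | iter_empty o => exact absurd hb (Pattern.not_occurs_neutral o _ _ _)
  | iter_unused o c _ h =>
    obtain ⟨i, hi⟩ := h w hctx
    refine ⟨i, hi, ?_⟩
    rwa [Pattern.occurs_subst, substVal_shift]
  | instantiation o c π e h =>
    rcases hb with hb | ⟨i, hi, hb⟩
    · refine ⟨e.eval w, ?_, ?_⟩
      · rw [← substVal_inst, ← Constraint.holds_subst]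
        refine h w ?_
        rwa [Constraint.holds_subst, substVal_shift, hd]
      · rwa [Pattern.occurs_subst, substVal_inst] at hb
    · exact ⟨i, hi.1, hb⟩
  | emptiness o o' c c' K' π₀ _ _ =>
    rcases hb with ⟨i, hi, hb⟩ | ⟨i, hi, hb⟩
    · exact ⟨i, hi.1, hb⟩
    · exact ⟨i, hi.1, occurs_plug_neutral K' o' hb⟩
  | prop_simpl b' k p e f _ _ =>
    obtain ⟨i, _, hb, hg⟩ := hb
    refine ⟨hb, ?_⟩
    rw [← hg]
    simp only [Atom.eval, LinExpr.eval_subst, substVal_shift, drop_one_scons]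

theorem finDom (h : Rewrite C Λ K π π') {w : ℕ → ℤ} (hπ : π.FinDom w) : π'.FinDom w := by
  cases h with
  | neg_top | neg_bot | and_bot | or_top => trivial
  | and_top | or_bot | idem => exact hπ.1
  | iter_neutral o | iter_empty o => exact Pattern.finDom_neutral o _
  | iter_unused o c _ h =>
    have h := hπ.2 0
    rwa [Pattern.finDom_subst, substVal_shift] at h
  | instantiation o c π e h =>
    refine ⟨?_, hπ.1.subset fun i hi => hi.1, hπ.2⟩
    rw [Pattern.finDom_subst, substVal_inst]
    exact hπ.2 _
  | emptiness o o' c c' K' π₀ _ _ =>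
    exact ⟨⟨hπ.1.subset fun i hi => hi.1, hπ.2⟩, hπ.1.subset fun i hi => hi.1,
      fun i => finDom_plug_neutral K' o' (hπ.2 i)⟩
  | prop_simpl b' k p e f _ _ =>
    refine ⟨(Set.finite_singleton 0).subset fun i hi => ?_, fun _ => trivial⟩
    have h := hi.2
    simp only [Constraint.Holds, Cmp.Holds, LinExpr.eval_var, LinExpr.eval_zero] at h
    exact h

/-- Suppose a parameter of `e` is free neither in the domain nor in `C`. Varying it keeps `C` true
and the range unchanged, yet `e` runs through infinitely many values, all in the range, which is
finite. So instantiation creates no new parameter. -/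
theorem vars_of_entails {c : Constraint} {e : LinExpr} {d n : ℕ} {w : ℕ → ℤ}
    (hw : C.Holds (drop d w)) (hfin : {i : ℤ | c.Holds (scons i w)}.Finite)
    (h : (C.subst (shift d)).Entails (c.subst (inst e))) (hn : n + d ∈ e.vars) :
    n + d + 1 ∈ c.fv ∨ n ∈ C.fv := by
  by_contra! hcon
  refine (Set.infinite_of_injective_forall_mem (f := fun x : ℤ =>
    e.eval (Function.update w (n + d) x)) ?_ fun x => ?_) hfin
  · intro x y hxy
    simp only [LinExpr.eval_update, add_right_inj] at hxy
    have := mul_left_cancel₀ hn hxy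
    omega
  · have hx := h (Function.update w (n + d) x) (by
      rw [Constraint.holds_subst, substVal_shift]
      refine (C.holds_congr fun m hm => ?_).1 hw
      have hne : m ≠ n := by
        rintro rfl
        exact hcon.2 hm
      simp only [drop]
      rw [Function.update_of_ne (by omega)])
    rw [Constraint.holds_subst, substVal_inst] at hx
    refine (c.holds_congr fun m hm => ?_).1 hx
    cases m with
    | zero => rfl
    | succ m =>
      have hne : m ≠ n + d := by
        rintro rfl
        exact hcon.1 hm
      exact Function.update_of_ne hne _ _

theorem fv (h : Rewrite C Λ K π π') {w : ℕ → ℤ} (hw : C.Holds (drop K.depth w))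
    (hπ : π.FinDom w) {n : ℕ} (hn : n + K.depth ∈ π'.fv) :
    n + K.depth ∈ π.fv ∨ n ∈ C.fv ∪ (litsPattern Λ).fv := by
  cases h with
  | neg_top | neg_bot | and_bot | or_top => exact hn.elim
  | and_top | or_bot | idem => exact Or.inl (Or.inl hn)
  | iter_neutral o | iter_empty o => exact ((Pattern.fv_neutral o).subset hn).elim
  | iter_unused o c _ h =>
    exact Or.inl (Or.inr (Pattern.mem_fv_subst (r := (· + 1)) (add_left_injective 1)
      (fun _ => rfl) _ hn))
  | instantiation o c π e h =>
    have he (hn : n + K.depth ∈ e.vars) :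
        n + K.depth ∈ (Pattern.iter o c π).fv ∨ n ∈ C.fv ∪ (litsPattern Λ).fv :=
      (vars_of_entails hw hπ.1 h hn).imp Or.inl Or.inl
    rcases hn with hn | (hn | hn) | hn
    · obtain ⟨m, hm, hn⟩ := Pattern.fv_subst_subset _ _ hn
      cases m with
      | zero => exact he hn
      | succ m =>
        simp only [inst, scons, LinExpr.vars_var, Set.mem_singleton_iff] at hn
        exact Or.inl (Or.inr (hn ▸ hm))
    · exact Or.inl (Or.inl hn)
    · rcases hn with hn | hn
      · simp [LinExpr.vars_var] at hn
      · obtain ⟨m, hm, hn⟩ := LinExpr.vars_subst_subset _ _ hn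
        simp only [shift, LinExpr.vars_var, Set.mem_singleton_iff, add_left_inj] at hn
        exact he (hn ▸ hm)
    · exact Or.inl (Or.inr hn)
  | emptiness o o' c c' K' π₀ _ _ =>
    refine Or.inl ?_
    have hc' (h : n + K.depth + 1 + 1 ∈ c'.fv) : n + K.depth + 1 ∈
        (K'.plug (.iter o' (c'.subst (lift (shift K'.depth))) π₀)).fv := by
      refine K'.mem_fv_plug (Or.inl ?_)
      refine Constraint.mem_fv_subst (r := liftRename (· + K'.depth))
        (liftRename_injective (add_left_injective _)) (lift_rename fun _ => rfl) c' h
    rcases hn with ((hn | hn) | hn) | ((hn | hn) | hn)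
    · exact Or.inl hn
    · exact Or.inr (hc' hn)
    · exact Or.inr hn
    · exact Or.inl hn
    · exact Or.inr (hc' hn)
    · exact Or.inr (fv_plug_neutral K' o' _ hn)
  | prop_simpl b' k p e f hmem _ =>
    have he {j : Fin k} (hn : n + K.depth + 1 ∈ ((e j).subst (shift 1)).vars) :
        n + K.depth ∈ (e j).vars := by
      obtain ⟨m, hm, hn⟩ := LinExpr.vars_subst_subset _ _ hn
      simp only [shift, LinExpr.vars_var, Set.mem_singleton_iff, add_left_inj] at hn
      exact hn ▸ hm
    rcases hn with (hn | hn) | ⟨j, hn⟩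
    · obtain ⟨j, hn | hn⟩ := (Constraint.fv_someNe _ _).1 hn
      · exact Or.inl ⟨j, he hn⟩
      · obtain ⟨m, hm, hn⟩ := LinExpr.vars_subst_subset _ _ hn
        simp only [shift, LinExpr.vars_var, Set.mem_singleton_iff] at hn
        obtain rfl : n = m := by omega
        exact Or.inr (Or.inr ((fv_litsPattern Λ).2 ⟨_, hmem, j, hm⟩))
    · simp [Constraint.fv, LinExpr.vars_var, LinExpr.vars_zero] at hn
    · exact Or.inl ⟨j, he hn⟩

end Rewrite

/-! ### The weight drops under rewriting -/

theorem one_le_iterCost (s : Set ℤ) (b : ℤ → ℕ) : 1 ≤ iterCost s b :=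
  (Nat.one_le_pow _ _ (by norm_num)).trans (Nat.le_add_right _ _)

theorem iterCost_remove {s : Set ℤ} (hs : s.Finite) {a : ℤ} (ha : a ∈ s) (b : ℤ → ℕ) :
    5 ^ b a + iterCost (s \ {a}) b = iterCost s b := by
  rw [iterCost, iterCost, ← sumOver_remove hs ha]
  ring

/-- The two parts share the range, but each counts the value `0`; this doubling is the factor `2`.
The second estimate leaves room for the connective and the new flags. -/
theorem iterCost_split {s : Set ℤ} (hs : s.Finite) (p : ℤ → Prop) {b b₁ b₂ : ℤ → ℕ}
    (h₁ : ∀ i, b₁ i < b i) (h₂ : ∀ i, b₂ i < b i) :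
    5 * (iterCost {i | i ∈ s ∧ p i} b₁ + iterCost {i | i ∈ s ∧ ¬ p i} b₂) ≤ 2 * iterCost s b ∧
      5 ≤ iterCost s b := by
  have h₁' := h₁
  have h₁ := five_iterCost_le {i | i ∈ s ∧ p i} h₁
  have h₂ := five_iterCost_le {i | i ∈ s ∧ ¬ p i} h₂
  have hs := sumOver_split hs p fun i => 5 ^ b i
  have h₃ : 5 * 5 ^ b₁ 0 ≤ 5 ^ b 0 := five_pow_le (h₁' 0)
  have h₄ : 1 ≤ 5 ^ b₁ 0 := Nat.one_le_pow _ _ (by norm_num)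
  simp only [iterCost] at h₁ h₂ ⊢
  constructor <;> omega

theorem iterCost_subset_singleton {s : Set ℤ} {a : ℤ} (hs : s ⊆ {a}) (m : ℕ) :
    iterCost s (fun _ => m) ≤ 2 * 5 ^ m := by
  have h : sumOver s (fun _ => 5 ^ m) ≤ 5 ^ m := by
    rw [sumOver_of_finite ((Set.finite_singleton a).subset hs), Finset.sum_const, smul_eq_mul]
    refine (Nat.mul_le_mul_right _ (Finset.card_le_one.2 fun i hi j hj => ?_)).trans_eq
      (one_mul _)
    rw [hs ((Set.Finite.mem_toFinset _).1 hi), hs ((Set.Finite.mem_toFinset _).1 hj)]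
  simp only [iterCost]
  omega

namespace Pattern

variable (Λ : Finset (Literal P))

theorem lt_weight_iter (o : Op) (c : Constraint) (π : Pattern P) (d : ℕ) (Y X : Set (ℕ → ℤ))
    (w : ℕ → ℤ) : π.weight Λ (d + 1) (under Y) (underDom X c) (scons 0 w) <
      (iter o c π).weight Λ d Y X w := by
  have h := lt_iterCost (range c w)
    fun i => π.weight Λ (d + 1) (under Y) (underDom X c) (scons i w)
  have h' := Nat.le_mul_of_pos_left (iterCost (range c w)
    fun i => π.weight Λ (d + 1) (under Y) (underDom X c) (scons i w)) (n := 4 + c.ineqs) (by omega)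
  simp only [weight]
  omega

theorem weight_iter_pos (o : Op) (c : Constraint) (π : Pattern P) (d : ℕ) (Y X : Set (ℕ → ℤ))
    (w : ℕ → ℤ) : 0 < (iter o c π).weight Λ d Y X w :=
  (Nat.zero_le _).trans_lt (lt_weight_iter Λ o c π d Y X w)

/-- The weight drops if a domain is no longer empty under any valuation in `X`, or in `Y`. -/
theorem weight_iter_lt_of_flag (o : Op) (c : Constraint) (π : Pattern P) (d : ℕ)
    {Y Y' X X' : Set (ℕ → ℤ)} (hY : Y' ⊆ Y) (hX : X' ⊆ X)
    (h : emptyFlag X' c < emptyFlag X c ∨ emptyFlag Y' c < emptyFlag Y c) (w : ℕ → ℤ) :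
    (iter o c π).weight Λ d Y' X' w < (iter o c π).weight Λ d Y X w := by
  have h₁ := emptyFlag_mono hX c
  have h₂ := emptyFlag_mono hY c
  have h₃ := Nat.mul_le_mul_left (4 + c.ineqs) (iterCost_mono (range c w) fun i =>
    π.weight_mono Λ (d + 1) (under_mono hY) (underDom_mono hX c) (scons i w))
  simp only [weight]
  omega

/-- Instantiation sends every valuation in `X` to one that satisfies the domain, so the instance
sees no more valuations than the body did. -/
theorem weight_inst_le (π : Pattern P) (e : LinExpr) (c : Constraint) (d : ℕ)
    (Y X : Set (ℕ → ℤ)) (h : ∀ u ∈ X, c.Holds (scons (e.eval u) u)) (w : ℕ → ℤ) :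
    (π.subst (inst e)).weight Λ d Y X w ≤
      π.weight Λ (d + 1) (under Y) (underDom X c) (scons (e.eval w) w) := by
  rw [weight_subst Λ (d' := d + 1) (fun w => by rw [substVal_inst, drop_succ_scons]), substVal_inst]
  refine weight_mono Λ π _ ?_ ?_ _
  · rintro _ ⟨u, hu, rfl⟩
    rw [substVal_inst]
    exact hu
  · rintro _ ⟨u, hu, rfl⟩
    rw [substVal_inst]
    exact ⟨hu, h u hu⟩

/-- Removing the binder must not enlarge the context. It does not, since each valuation in `X`
extends to one in the domain. -/
theorem weight_le_shift (π : Pattern P) (c : Constraint) (d : ℕ) (Y X : Set (ℕ → ℤ))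
    (h : ∀ u ∈ X, ∃ i, c.Holds (scons i u)) (w : ℕ → ℤ) : π.weight Λ d Y X w ≤
      (π.subst (shift 1)).weight Λ (d + 1) (under Y) (underDom X c) (scons 0 w) := by
  rw [weight_subst Λ (d' := d) (fun w => by rw [substVal_shift, drop_one_drop]), substVal_shift,
    drop_one_scons]
  refine weight_mono Λ π _ (fun u hu => ?_) (fun u hu => ?_) _
  · exact ⟨scons 0 u, hu, substVal_shift _ _⟩
  · obtain ⟨i, hi⟩ := h u hu
    exact ⟨scons i u, ⟨hu, hi⟩, substVal_shift _ _⟩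

end Pattern

open Pattern in
-- Only `C`, not the whole context, is assumed at `w`, as `weight_plug` demands. This suffices for
-- instantiation, whose side condition is an entailment from `C` alone; the other rules use the
-- context only through the set `X`.
theorem Rewrite.weight_lt {C : Constraint} {Λ : Finset (Literal P)} {K : Surround P}
    {π π' : Pattern P} (h : Rewrite C Λ K π π') {w : ℕ → ℤ} (hw : C.Holds (drop K.depth w))
    (hπ : π.FinDom w) :
    π'.weight Λ K.depth {u | drop K.depth u ∈ {ρ | C.Holds ρ}} (K.contextSet {ρ | C.Holds ρ}) w <
      π.weight Λ K.depth {u | drop K.depth u ∈ {ρ | C.Holds ρ}}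
        (K.contextSet {ρ | C.Holds ρ}) w := by
  generalize hY : {u | drop K.depth u ∈ {ρ | C.Holds ρ}} = Y
  generalize hX : K.contextSet {ρ | C.Holds ρ} = X
  have hXC {u : ℕ → ℤ} (hu : u ∈ X) : C.Holds (drop K.depth u) := by
    subst hX
    exact Surround.drop_mem hu
  have hctx {u : ℕ → ℤ} : u ∈ X ↔ (K.context C).Holds u := by
    rw [← hX]
    exact Surround.mem_contextSet C K u
  cases h with
  | neg_top | neg_bot | and_bot | or_top | and_top | or_bot | idem =>
    simp only [weight]
    omega
  | iter_neutral o | iter_empty o =>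
    rw [weight_neutral]
    exact weight_iter_pos ..
  | iter_unused o c _ h =>
    exact (weight_le_shift Λ π' c _ Y X (fun u hu => h u (hctx.1 hu)) w).trans_lt
      (lt_weight_iter ..)
  | instantiation o c π e h =>
    have he (u : ℕ → ℤ) (hu : C.Holds (drop K.depth u)) : c.Holds (scons (e.eval u) u) := by
      rw [← substVal_inst, ← Constraint.holds_subst]
      refine h u ?_
      rwa [Constraint.holds_subst, substVal_shift]
    set ne : Constraint := .neg (.cmp .eq (.var 0) (e.subst (shift 1))) with hne_def
    have hne (i : ℤ) : ne.Holds (scons i w) ↔ i ≠ e.eval w := by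
      simp only [hne_def, Constraint.Holds, Cmp.Holds, LinExpr.eval_var, LinExpr.eval_subst,
        substVal_shift, drop_one_scons]
      rfl
    have hq : (c.and ne).ineqs = c.ineqs := by
      simp [hne_def, Constraint.ineqs, Constraint.conjuncts,
        Constraint.IsIneq, ← Multiset.cons_zero, Multiset.countP_cons]
    have hrange : range (c.and ne) w = range c w \ {e.eval w} := by
      ext i
      exact and_congr_right fun _ => hne i
    have h₁ := weight_inst_le Λ π e c K.depth Y X (fun u hu => he u (hXC hu)) w
    have h₂ := iterCost_remove (s := range c w) hπ.1 (he w hw)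
      fun i => π.weight Λ (K.depth + 1) (under Y) (underDom X c) (scons i w)
    have h₃ := iterCost_mono (range c w \ {e.eval w}) fun i => π.weight_mono Λ (K.depth + 1)
      (le_refl (under Y)) (X := underDom X (c.and ne)) (X' := underDom X c)
      (fun u hu => ⟨hu.1, hu.2.1⟩) (scons i w)
    have h₄ := emptyFlag_le_one X (c.and ne)
    have h₅ := emptyFlag_le_one Y (c.and ne)
    simp only [weight, hq, hrange]
    rw [← h₂, mul_add]
    have h₆ := Nat.mul_le_mul_left (4 + c.ineqs) h₃
    set b := π.weight Λ (K.depth + 1) (under Y) (underDom X c) (scons (e.eval w) w)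
    -- The value taken out of the range frees at least `4 * 5 ^ b`; the instance, the connective and
    -- two flags cost at most `b + 3`.
    have h₇ : b < 5 ^ b := Nat.lt_pow_self (by norm_num)
    have h₈ : 4 * 5 ^ b ≤ (4 + c.ineqs) * 5 ^ b := Nat.mul_le_mul_right _ (by omega)
    omega
  | emptiness o o' c c' K' π₀ hfree h =>
    have hq₁ : (c.and (.ex c')).ineqs = c.ineqs := by
      simp [Constraint.ineqs, Constraint.conjuncts,
        Constraint.IsIneq, ← Multiset.cons_zero, Multiset.countP_cons]
    have hq₂ : (c.and (.all (.neg c'))).ineqs = c.ineqs := by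
      simp [Constraint.ineqs, Constraint.conjuncts,
        Constraint.IsIneq, ← Multiset.cons_zero, Multiset.countP_cons]
    have hsub (δ : Constraint) : underDom X (c.and δ) ⊆ underDom X c :=
      fun u hu => ⟨hu.1, hu.2.1⟩
    -- The side condition says that the inner domain can be empty in its context. In the first copy
    -- the new conjunct rules this out, so the flag falls from `1` to `0`.
    have hflag : emptyFlag (K'.contextSet (underDom X c))
        (c'.subst (lift (shift K'.depth))) = 1 := by
      obtain ⟨u, hu, hu'⟩ := h
      refine emptyFlag_eq_one ⟨u, ?_, fun i => ?_⟩
      · rw [← Surround.mem_contextSet, Surround.contextSet_append] at hu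
        simp only [Surround.contextSet, hX] at hu
        exact hu
      · rw [holds_lift_shift]
        rw [Constraint.holds_subst, substVal_shift] at hu'
        exact hu' i
    have hflag' : emptyFlag (K'.contextSet (underDom X (c.and (.ex c'))))
        (c'.subst (lift (shift K'.depth))) = 0 := by
      refine emptyFlag_eq_zero fun u hu => ?_
      simp only [holds_lift_shift]
      exact (Surround.drop_mem hu).2.2
    have h₁ (i : ℤ) := weight_plug Λ (d := K.depth + 1) (le_refl (under Y))
      (hsub (.ex c')) (ρ := scons i w) K' fun u _ => weight_iter_lt_of_flag Λ o'
        (c'.subst (lift (shift K'.depth))) π₀ (K.depth + 1 + K'.depth) subset_rfl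
        (Surround.contextSet_mono (hsub (.ex c')) K') (Or.inl (by rw [hflag, hflag']; simp)) u
    have h₂ (i : ℤ) := weight_plug Λ (d := K.depth + 1) (le_refl (under Y))
      (hsub (.all (.neg c'))) (ρ := scons i w) K'
      (π := .iter o' (c'.subst (lift (shift K'.depth))) π₀) (π' := .neutral o') fun u _ => by
        rw [weight_neutral]
        exact weight_iter_pos ..
    obtain ⟨h₃, h₄⟩ := iterCost_split hπ.1 (fun i => ∃ j, c'.Holds (scons j (scons i w))) h₁ h₂
    have hr₁ : range (c.and (.ex c')) w = {i | i ∈ {i | c.Holds (scons i w)} ∧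
      ∃ j, c'.Holds (scons j (scons i w))} := rfl
    have hr₂ : range (c.and (.all (.neg c'))) w = {i | i ∈ {i | c.Holds (scons i w)} ∧
        ¬ ∃ j, c'.Holds (scons j (scons i w))} := by
      ext i
      exact and_congr_right fun _ => not_exists.symm
    have h₅ := emptyFlag_le_one X (c.and (.ex c'))
    have h₆ := emptyFlag_le_one Y (c.and (.ex c'))
    have h₇ := emptyFlag_le_one X (c.and (.all (.neg c')))
    have h₈ := emptyFlag_le_one Y (c.and (.all (.neg c')))
    simp only [weight, hq₁, hq₂, hr₁, hr₂]
    rw [range]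
    have h₉ := Nat.mul_le_mul_left (4 + c.ineqs) h₃
    have h₁₀ := Nat.mul_le_mul (show 4 ≤ 4 + c.ineqs by omega) h₄
    rw [mul_add, mul_add, mul_left_comm, mul_left_comm _ 5, mul_left_comm _ 2] at h₉
    omega
  | prop_simpl b k p e f hmem h =>
    classical
    set c : Constraint := (Constraint.someNe (fun j => (e j).subst (shift 1))
      fun j => (f j).subst (shift (K.depth + 1))).and (.cmp .eq (.var 0) 0) with hc
    have hq : c.ineqs = 0 := by
      rw [hc, Constraint.ineqs_and, Constraint.someNe, Constraint.ineqs_disjAll]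
      simp [Constraint.ineqs, Constraint.conjuncts, Constraint.IsIneq, ← Multiset.cons_zero]
    have hrange : range c w ⊆ {0} := by
      intro i hi
      have h := hi.2
      simp only [Constraint.Holds, Cmp.Holds, LinExpr.eval_var, LinExpr.eval_zero] at h
      exact h
    -- The new domain excludes agreement with the chosen literal, while the side condition says that
    -- agreement was possible before.
    have hlt : unifiable Λ (K.depth + 1) (underDom X c)
        (⟨k, p, fun j => (e j).subst (shift 1)⟩ : Atom P) <
          unifiable Λ K.depth X (⟨k, p, e⟩ : Atom P) := by
      have hev (u : ℕ → ℤ) : Atom.eval u (⟨k, p, fun j => (e j).subst (shift 1)⟩ : Atom P) =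
          Atom.eval (drop 1 u) (⟨k, p, e⟩ : Atom P) := by
        simp only [Atom.eval, LinExpr.eval_subst, substVal_shift]
      refine Finset.card_lt_card ((Finset.ssubset_iff_of_subset fun L hL => ?_).2
        ⟨(b, ⟨k, p, f⟩), ?_, ?_⟩)
      · rw [Finset.mem_filter] at hL ⊢
        obtain ⟨hL, u, hu, h'⟩ := hL
        rw [hev] at h'
        exact ⟨hL, drop 1 u, hu.1, h'⟩
      · rw [Finset.mem_filter]
        obtain ⟨u, hu, h'⟩ := h
        rw [Constraint.holds_allEq] at h'
        refine ⟨hmem, u, hctx.2 hu, ?_⟩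
        simp only [Atom.eval, h', LinExpr.eval_subst, substVal_shift]
      · rw [Finset.mem_filter]
        rintro ⟨-, u, hu, h'⟩
        refine (Constraint.holds_someNe _ _ _).1 hu.2.1 fun j => ?_
        simp only [Atom.eval, Sigma.mk.injEq, heq_eq_eq, Prod.mk.injEq, true_and] at h'
        rw [congrFun h' j, LinExpr.eval_subst, substVal_shift]
    have h₁ := atomWeight_mono (Nat.succ_le_of_lt hlt)
    have h₂ := iterCost_subset_singleton hrange (atomWeight (unifiable Λ (K.depth + 1)
      (underDom X c) (⟨k, p, fun j => (e j).subst (shift 1)⟩ : Atom P)))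
    have h₃ := emptyFlag_le_one X c
    have h₄ := emptyFlag_le_one Y c
    simp only [weight, hq]
    simp only [atomWeight] at h₁
    omega

/-! ### The extension rules -/

/-- In a node with constraint `C` and literals `Λ`, the subpattern `π` at the position `K` may be
replaced by `π'` while the constraint is strengthened to `C'`: this preserves the models of `C'`
and makes the weight drop. -/
structure Replacement (C : Constraint) (Λ : Finset (Literal P)) (K : Surround P) (π : Pattern P)
    (C' : Constraint) (π' : Pattern P) : Prop where
  entails : C'.Entails C
  fv_mono : C.fv ⊆ C'.fv
  fv_cstr : C'.fv ⊆ C.fv ∪ (K.plug π).fv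
  holds_iff : ∀ (I : GroundAtom P → Prop) (ρ w : ℕ → ℤ), C'.Holds ρ → (∀ L ∈ Λ, L.Holds I ρ) →
    w ∈ K.contextSet {ρ} → (π'.Holds I w ↔ π.Holds I w)
  occurs : ∀ (g : GroundAtom P) (b : Bool) (ρ w : ℕ → ℤ), C'.Holds ρ → w ∈ K.contextSet {ρ} →
    π'.Occurs g b w → π.Occurs g b w
  finDom : ∀ w, C'.Holds (drop K.depth w) → π.FinDom w → π'.FinDom w
  fv_pat : ∀ w n, C'.Holds (drop K.depth w) → π.FinDom w → n + K.depth ∈ π'.fv →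
    n + K.depth ∈ π.fv ∨ n ∈ C.fv ∪ (litsPattern Λ).fv
  weight_lt : ∀ w, C'.Holds (drop K.depth w) → π.FinDom w →
    π'.weight Λ K.depth {u | drop K.depth u ∈ {ρ | C'.Holds ρ}}
        (K.contextSet {ρ | C'.Holds ρ}) w <
      π.weight Λ K.depth {u | drop K.depth u ∈ {ρ | C.Holds ρ}} (K.contextSet {ρ | C.Holds ρ}) w

theorem Rewrite.replacement {C : Constraint} {Λ : Finset (Literal P)} {K : Surround P}
    {π π' : Pattern P} (h : Rewrite C Λ K π π') : Replacement C Λ K π C π' where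
  entails _ h := h
  fv_mono := subset_rfl
  fv_cstr := Set.subset_union_left
  holds_iff _ _ _ hρ hΛ hw := h.holds_iff hρ hΛ hw
  occurs _ _ _ _ hρ hw := h.occurs hρ hw
  finDom _ _ := h.finDom
  fv_pat _ _ hw hπ := h.fv hw hπ
  weight_lt _ hw hπ := h.weight_lt hw hπ

section ConstraintSplit

variable {C c : Constraint} {K : Surround P}

theorem fv_ex_subset (C : Constraint) (K : Surround P) (o : Op) (c : Constraint) (π : Pattern P) :
    C.fv ∪ {n | n + 1 ∈ c.fv} ⊆
      C.fv ∪ (K.plug (.iter o (c.subst (lift (shift K.depth))) π)).fv := by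
  refine Set.union_subset_union_right _ fun n hn => K.mem_fv_plug (Or.inl ?_)
  exact Constraint.mem_fv_subst (r := liftRename (· + K.depth))
    (liftRename_injective (add_left_injective _)) (lift_rename fun _ => rfl) c hn

theorem contextSet_and (C δ : Constraint) (K : Surround P) :
    K.contextSet {ρ | (C.and δ).Holds ρ} ⊆ K.contextSet {ρ | C.Holds ρ} :=
  Surround.contextSet_mono (fun _ h => h.1) K

/-- The pattern stays the same; what drops is the flag over `Y`. The flag over `X` would not do: the
valuation given by `h` satisfies `C`, but perhaps no extension of it satisfies the domains around
the hole. -/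
theorem replacement_nonempty (Λ : Finset (Literal P)) (o : Op) (π : Pattern P)
    (h : (C.and (.all (.neg c))).Satisfiable) :
    Replacement C Λ K (.iter o (c.subst (lift (shift K.depth))) π) (C.and (.ex c))
      (.iter o (c.subst (lift (shift K.depth))) π) where
  entails _ h := h.1
  fv_mono := Set.subset_union_left
  fv_cstr := fv_ex_subset C K o c π
  holds_iff _ _ _ _ _ _ := Iff.rfl
  occurs _ _ _ _ _ _ := id
  finDom _ _ := id
  fv_pat _ _ _ _ := Or.inl
  weight_lt w _ _ := by
    refine Pattern.weight_iter_lt_of_flag Λ o _ π _ (fun u hu => hu.1) (contextSet_and C _ K)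
      (Or.inr ?_) w
    rw [emptyFlag_eq_zero, emptyFlag_eq_one]
    · exact one_pos
    · obtain ⟨ρ, hρ, hc⟩ := h
      obtain ⟨u, rfl⟩ := exists_drop_eq K.depth ρ
      refine ⟨u, hρ, fun i => ?_⟩
      rw [holds_lift_shift]
      exact hc i
    · intro u hu
      simp only [holds_lift_shift]
      exact hu.2

theorem replacement_empty (Λ : Finset (Literal P)) (o : Op) (π : Pattern P) :
    Replacement C Λ K (.iter o (c.subst (lift (shift K.depth))) π) (C.and (.all (.neg c)))
      (.neutral o) where
  entails _ h := h.1
  fv_mono := Set.subset_union_left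
  fv_cstr := fv_ex_subset C K o c π
  holds_iff I ρ w hρ _ hw := holds_neutral_iff o fun i => by
    rw [holds_lift_shift, show drop K.depth w = ρ from Surround.drop_mem hw]
    exact hρ.2 i
  occurs _ _ _ _ _ _ h := absurd h (Pattern.not_occurs_neutral o _ _ _)
  finDom _ _ _ := Pattern.finDom_neutral o _
  fv_pat _ _ _ _ h := ((Pattern.fv_neutral o).subset h).elim
  weight_lt w _ _ := by
    rw [Pattern.weight_neutral]
    exact Pattern.weight_iter_pos ..

end ConstraintSplit

/-- Under `C'` both domains have the same range, so costs and flags cannot grow; the factor that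
counts inequalities drops, and the cost it multiplies is at least `1`. -/
theorem replacement_domain {C C' δ δ' : Constraint} {K : Surround P} (Λ : Finset (Literal P))
    (o : Op) (π : Pattern P) (hC : C'.Entails C) (hfv : C.fv ⊆ C'.fv)
    (hfv' : C'.fv ⊆ C.fv ∪ {n | n + K.depth + 1 ∈ δ.fv}) (hδfv : δ'.fv ⊆ δ.fv)
    (hδ : ∀ w i, C'.Holds (drop K.depth w) → (δ'.Holds (scons i w) ↔ δ.Holds (scons i w)))
    (hq : δ'.ineqs < δ.ineqs) : Replacement C Λ K (.iter o δ π) C' (.iter o δ' π) where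
  entails := hC
  fv_mono := hfv
  fv_cstr := hfv'.trans
    (Set.union_subset_union_right _ fun _ hn => K.mem_fv_plug (Or.inl hn))
  holds_iff I ρ w hρ _ hw := by
    have hw := Surround.drop_mem hw
    have h i := hδ w i (hw.symm ▸ hρ)
    cases o <;> simp only [Pattern.Holds, h]
  occurs g b ρ w hρ hw := by
    have hw := Surround.drop_mem hw
    rintro ⟨i, hi, hb⟩
    exact ⟨i, (hδ w i (hw.symm ▸ hρ)).1 hi, hb⟩
  finDom w hw h := ⟨h.1.subset fun i hi => (hδ w i hw).1 hi, h.2⟩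
  fv_pat w n _ _ := Or.inl ∘ Or.imp_left fun h => hδfv h
  weight_lt w hw _ := by
    generalize hY' : {u | drop K.depth u ∈ {ρ | C'.Holds ρ}} = Y'
    generalize hY : {u | drop K.depth u ∈ {ρ | C.Holds ρ}} = Y
    generalize hX' : K.contextSet {ρ | C'.Holds ρ} = X'
    generalize hX : K.contextSet {ρ | C.Holds ρ} = X
    have hYY : Y' ⊆ Y := by
      rw [← hY', ← hY]
      exact fun u hu => hC _ hu
    have hXX : X' ⊆ X := by
      rw [← hX', ← hX]
      exact Surround.contextSet_mono hC K
    have hY'C {u : ℕ → ℤ} (hu : u ∈ Y') : C'.Holds (drop K.depth u) := by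
      rwa [← hY'] at hu
    have hX'C {u : ℕ → ℤ} (hu : u ∈ X') : C'.Holds (drop K.depth u) := by
      rw [← hX'] at hu
      exact Surround.drop_mem hu
    have hrange : range δ' w = range δ w := by
      ext i
      exact hδ w i hw
    have h₁ : emptyFlag X' δ' ≤ emptyFlag X δ :=
      emptyFlag_le fun u hu h => ⟨u, hXX hu, fun i hi => h i ((hδ u i (hX'C hu)).2 hi)⟩
    have h₂ : emptyFlag Y' δ' ≤ emptyFlag Y δ :=
      emptyFlag_le fun u hu h => ⟨u, hYY hu, fun i hi => h i ((hδ u i (hY'C hu)).2 hi)⟩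
    have hdom : underDom X' δ' ⊆ underDom X δ := by
      rintro u ⟨hu, h⟩
      refine ⟨hXX hu, ?_⟩
      rw [← scons_drop_one u] at h ⊢
      exact (hδ _ _ (hX'C hu)).1 h
    have h₃ := iterCost_mono (range δ w) fun i => π.weight_mono Λ (K.depth + 1) (under_mono hYY)
      hdom (scons i w)
    have h₄ := (Nat.mul_le_mul_left (4 + δ'.ineqs) h₃).trans_lt
      (Nat.mul_lt_mul_of_pos_right (show 4 + δ'.ineqs < 4 + δ.ineqs by omega)
        (one_le_iterCost _ _))
    simp only [Pattern.weight, hrange]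
    omega

/-- Multiply by `l`, compare `l * a` with `k * b`, and cancel `k`. -/
theorem Cmp.holds_of_interval {r : Cmp} (hr : r ≠ .eq) {k l : ℕ} (hk : 0 < k) (hl : 0 < l)
    {i a b : ℤ} (h : r.Holds (l * a) (k * b)) (h' : r.Holds (k * i) a) : r.Holds (l * i) b := by
  have hk : (0 : ℤ) < k := by exact_mod_cast hk
  have hl : (0 : ℤ) < l := by exact_mod_cast hl
  cases r with
  | eq => exact absurd rfl hr
  | lt | le | ge | gt =>
    simp only [Cmp.Holds] at *
    by_contra! hcon
    nlinarith [mul_le_mul_of_nonneg_left hcon hk.le]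

theorem Cmp.holds_of_not_interval {r : Cmp} (hr : r ≠ .eq) {k l : ℕ} (hk : 0 < k) (hl : 0 < l)
    {i a b : ℤ} (h : ¬ r.Holds (l * a) (k * b)) (h' : r.Holds (l * i) b) : r.Holds (k * i) a := by
  have hk : (0 : ℤ) < k := by exact_mod_cast hk
  have hl : (0 : ℤ) < l := by exact_mod_cast hl
  cases r with
  | eq => exact absurd rfl hr
  | lt | le | ge | gt =>
    simp only [Cmp.Holds] at *
    by_contra! hcon
    nlinarith

section Interval

variable {C δ c : Constraint} {K : Surround P} {r : Cmp} {k l : ℕ} {e₁ e₂ : LinExpr}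

/-- Serves both conclusions of the interval rule, the second one with the two bounds exchanged:
under `C₀` the bound that is kept implies the one that is removed. -/
theorem replacement_interval {C₀ : Constraint} (Λ : Finset (Literal P)) (o : Op) (π : Pattern P)
    (hr : r ≠ .eq)
    (hδ : δ.conjuncts = c.conjuncts +
      {.cmp r (k • .var 0) (e₁.subst (shift (K.depth + 1))),
        .cmp r (l • .var 0) (e₂.subst (shift (K.depth + 1)))})
    (hC₀ : C₀.fv ⊆ e₁.vars ∪ e₂.vars)
    (himp : ∀ ρ (i : ℤ), C₀.Holds ρ → r.Holds (k * i) (e₁.eval ρ) → r.Holds (l * i) (e₂.eval ρ)) :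
    Replacement C Λ K (.iter o δ π) (C.and C₀)
      (.iter o (c.and (.cmp r (k • .var 0) (e₁.subst (shift (K.depth + 1))))) π) := by
  have hmem {n : ℕ} {e : LinExpr} (hn : n ∈ e.vars) :
      n + K.depth + 1 ∈ (e.subst (shift (K.depth + 1))).vars :=
    LinExpr.mem_vars_subst (r := (· + (K.depth + 1))) (add_left_injective _) (fun _ => rfl) hn
  refine replacement_domain Λ o π (fun _ h => h.1) Set.subset_union_left
    (Set.union_subset_union_right _ fun n hn => ?_) (fun n hn => ?_) (fun w i hw => ?_) ?_
  · rw [Set.mem_ofPred_eq, Constraint.fv_iff_conjuncts, hδ]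
    rcases hC₀ hn with hn | hn
    · exact ⟨_, Multiset.mem_add.2 (Or.inr (Multiset.mem_cons_self _ _)), Or.inr (hmem hn)⟩
    · exact ⟨_, Multiset.mem_add.2 (Or.inr (Multiset.mem_cons_of_mem
        (Multiset.mem_singleton_self _))), Or.inr (hmem hn)⟩
  · rw [Constraint.fv_iff_conjuncts, hδ]
    rcases hn with hn | hn
    · rw [Constraint.fv_iff_conjuncts] at hn
      obtain ⟨c', hc', hn⟩ := hn
      exact ⟨c', Multiset.mem_add.2 (Or.inl hc'), hn⟩
    · exact ⟨_, Multiset.mem_add.2 (Or.inr (Multiset.mem_cons_self _ _)), hn⟩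
  · rw [δ.holds_iff_conjuncts, hδ]
    simp only [Multiset.mem_add, or_imp, forall_and, Multiset.insert_eq_cons, Multiset.mem_cons,
      Multiset.mem_singleton, forall_eq, ← Constraint.holds_iff_conjuncts]
    simp only [Constraint.Holds, LinExpr.eval_nsmul, LinExpr.eval_var, LinExpr.eval_subst,
      substVal_shift, drop_succ_scons]
    exact and_congr_right fun _ => ⟨fun h => ⟨h, himp _ i hw.2 h⟩, And.left⟩
  · have hcmp (e f : LinExpr) : (Constraint.cmp r e f).IsIneq := hr
    simp only [Constraint.ineqs, Constraint.conjuncts, hδ, Multiset.countP_add,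
      Multiset.insert_eq_cons, ← Multiset.cons_zero, Multiset.countP_cons, hcmp, if_true,
      Multiset.countP_zero]
    omega

end Interval

/-! ### The invariant of nodes and the measure -/

/-- What the descendants of a root labelled with the schema `S₀` satisfy. -/
structure NodeInv (S₀ : Schema P) (l : Label P) : Prop where
  fv_mono : S₀.cstr.fv ⊆ l.sch.cstr.fv
  entails : l.sch.cstr.Entails S₀.cstr
  finDom : ∀ ρ, l.sch.cstr.Holds ρ → l.sch.pat.FinDom ρ
  params : l.sch.cstr.Satisfiable → l.full.params ⊆ S₀.params

/-- The number of propositional variables that occur in the realization under `ρ`, but in none of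
the literals. -/
noncomputable def Label.unassigned (l : Label P) (ρ : ℕ → ℤ) : ℕ :=
  ({g | ∃ b, l.sch.pat.Occurs g b ρ} \ {g | ∃ L ∈ l.lits, L.2.eval ρ = g}).ncard

/-- The measure that drops along the branches of a tableau. -/
noncomputable def Label.measure (l : Label P) (ρ : ℕ → ℤ) : ℕ ×ₗ ℕ :=
  toLex (l.unassigned ρ, l.sch.pat.weight l.lits 0 {ρ | l.sch.cstr.Holds ρ}
    {ρ | l.sch.cstr.Holds ρ} ρ)

theorem Label.isModel_full (l : Label P) (ρ : ℕ → ℤ) (I : GroundAtom P → Prop) :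
    l.full.IsModel ρ I ↔
      l.sch.cstr.Holds ρ ∧ l.sch.pat.Holds I ρ ∧ ∀ L ∈ l.lits, L.Holds I ρ :=
  and_congr_right fun _ => and_congr_right fun _ => holds_litsPattern I l.lits ρ

namespace Replacement

variable {C C' : Constraint} {Λ : Finset (Literal P)} {K : Surround P} {π π' : Pattern P}

theorem nodeInv (h : Replacement C Λ K π C' π') {S₀ : Schema P}
    (hl : NodeInv S₀ ⟨⟨K.plug π, C⟩, Λ⟩) : NodeInv S₀ ⟨⟨K.plug π', C'⟩, Λ⟩ where
  fv_mono := hl.fv_mono.trans h.fv_mono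
  entails ρ hρ := hl.entails ρ (h.entails ρ hρ)
  finDom ρ hρ := K.finDom_plug (fun w hw hπ => h.finDom w (hw.symm ▸ hρ) hπ)
    (hl.finDom ρ (h.entails ρ hρ))
  params := by
    rintro ⟨ρ, hρ⟩
    have hp := hl.params ⟨ρ, h.entails ρ hρ⟩
    obtain ⟨w, hw⟩ := exists_drop_eq K.depth ρ
    have hpat := K.fv_plug fun n hn => h.fv_pat w n (hw.symm ▸ hρ)
      (K.finDom_of_plug (hl.finDom ρ (h.entails ρ hρ)) hw) hn
    rintro n ((hn | hn) | hn)
    · rcases hpat hn with hn | hn | hn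
      · exact hp (Or.inl (Or.inl hn))
      · exact hp (Or.inr hn)
      · exact hp (Or.inl (Or.inr hn))
    · exact hp (Or.inl (Or.inr hn))
    · rcases h.fv_cstr hn with hn | hn
      · exact hp (Or.inr hn)
      · exact hp (Or.inl (Or.inl hn))

theorem isModel (h : Replacement C Λ K π C' π') {ρ : ℕ → ℤ} {I : GroundAtom P → Prop}
    (hm : (Label.full ⟨⟨K.plug π, C⟩, Λ⟩).IsModel ρ I) (hρ : C'.Holds ρ) :
    (Label.full ⟨⟨K.plug π', C'⟩, Λ⟩).IsModel ρ I := by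
  rw [Label.isModel_full] at hm ⊢
  exact ⟨hρ, (K.holds_plug (X := {ρ}) (fun w hw => h.holds_iff I ρ w hρ hm.2.2 hw) ρ rfl).2 hm.2.1,
    hm.2.2⟩

theorem measure_lt (h : Replacement C Λ K π C' π') {ρ : ℕ → ℤ} (hfin : (K.plug π).FinDom ρ)
    (hρ : C'.Holds ρ) : Label.measure ⟨⟨K.plug π', C'⟩, Λ⟩ ρ <
      Label.measure ⟨⟨K.plug π, C⟩, Λ⟩ ρ := by
  have hle : Label.unassigned ⟨⟨K.plug π', C'⟩, Λ⟩ ρ ≤ Label.unassigned ⟨⟨K.plug π, C⟩, Λ⟩ ρ := by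
    refine Set.ncard_le_ncard (Set.sdiff_subset_sdiff_left ?_) hfin.finite_occurs.sdiff
    rintro g ⟨b, hb⟩
    exact ⟨b, K.occurs_plug (X := {ρ}) (fun w hw b => h.occurs g b ρ w hρ hw) ρ rfl b hb⟩
  refine Prod.Lex.toLex_lt_toLex.2 (hle.lt_or_eq.imp_right fun h' => ⟨h', ?_⟩)
  refine Pattern.weight_plug Λ (fun u hu => h.entails u hu) (fun u hu => h.entails u hu) K
    fun w hw => ?_
  have hlt := h.weight_lt w (hw.symm ▸ hρ) (K.finDom_of_plug hfin hw)
  simp only [zero_add]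
  exact hlt

end Replacement

theorem nodeInv_insert {S₀ S : Schema P} {Λ Λ' : Finset (Literal P)} {a : Atom P}
    (hl : NodeInv S₀ ⟨S, Λ⟩) (ha : a.vars ⊆ S.params) (h : ∀ L ∈ Λ', L.2 = a ∨ L ∈ Λ) :
    NodeInv S₀ ⟨S, Λ'⟩ where
  fv_mono := hl.fv_mono
  entails := hl.entails
  finDom := hl.finDom
  params := by
    intro hs
    have hp := hl.params hs
    rintro n ((hn | hn) | hn)
    · exact hp (Or.inl (Or.inl hn))
    · obtain ⟨L, hL, hn⟩ := (fv_litsPattern Λ').1 hn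
      rcases h L hL with h | h
      · rcases ha (h ▸ hn) with hn | hn
        · exact hp (Or.inl (Or.inl hn))
        · exact hp (Or.inr hn)
      · exact hp (Or.inl (Or.inr ((fv_litsPattern Λ).2 ⟨L, h, hn⟩)))
    · exact hp (Or.inr hn)

/-- The variable `a.eval ρ` occurs and was undecided, so the first component drops. The weight may
grow with the new literal, which the lexicographic order permits. -/
theorem measure_insert_lt {S : Schema P} {Λ Λ' : Finset (Literal P)} {a : Atom P} {ρ : ℕ → ℤ}
    (hρ : S.cstr.Holds ρ) (hfin : S.pat.FinDom ρ)
    (halways : S.AlwaysOccurs true a ∨ S.AlwaysOccurs false a)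
    (hpos : ¬ Schema.MayOccur ⟨litsPattern Λ, S.cstr⟩ true a)
    (hneg : ¬ Schema.MayOccur ⟨litsPattern Λ, S.cstr⟩ false a)
    (hΛ : Λ ⊆ Λ') (ha : ∃ L ∈ Λ', L.2 = a) :
    Label.measure ⟨S, Λ'⟩ ρ < Label.measure ⟨S, Λ⟩ ρ := by
  refine Prod.Lex.toLex_lt_toLex.2 (Or.inl (Set.ncard_lt_ncard ?_ hfin.finite_occurs.sdiff))
  refine (Set.ssubset_iff_of_subset (Set.sdiff_subset_sdiff_right ?_)).2 ⟨a.eval ρ, ⟨?_, ?_⟩, ?_⟩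
  · rintro g ⟨L, hL, h⟩
    exact ⟨L, hΛ hL, h⟩
  · exact halways.elim (fun h => ⟨_, h ρ hρ⟩) fun h => ⟨_, h ρ hρ⟩
  · rintro ⟨⟨b, a'⟩, hL, h⟩
    have hocc := (occurs_litsPattern (a.eval ρ) b Λ ρ).2 ⟨a', hL, h⟩
    cases b with
    | true => exact hpos ⟨ρ, hρ, hocc⟩
    | false => exact hneg ⟨ρ, hρ, hocc⟩
  · obtain ⟨L, hL, rfl⟩ := ha
    exact fun h => h.2 ⟨L, hL, rfl⟩

/-! ### Extension rules preserve models and lower the measure -/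

/-- The conclusions of a rule that strengthens the constraint and replaces a subpattern. -/
def IsReplacement (l : Label P) (ls : List (Label P)) : Prop :=
  ∃ C Λ K π, l = ⟨⟨Surround.plug K π, C⟩, Λ⟩ ∧
    (∀ l' ∈ ls, ∃ C' π', l' = ⟨⟨K.plug π', C'⟩, Λ⟩ ∧ Replacement C Λ K π C' π') ∧
    ∀ ρ, C.Holds ρ → ∃ l' ∈ ls, l'.sch.cstr.Holds ρ

open Classical in
theorem Extension.cases_replacement {l : Label P} {ls : List (Label P)} (h : Extension l ls) :
    (∃ S Λ a, l = ⟨S, Λ⟩ ∧ ls = [⟨S, insert (true, a) Λ⟩, ⟨S, insert (false, a) Λ⟩] ∧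
      a.vars ⊆ S.params ∧ (S.AlwaysOccurs true a ∨ S.AlwaysOccurs false a) ∧
      ¬ Schema.MayOccur ⟨litsPattern Λ, S.cstr⟩ true a ∧
      ¬ Schema.MayOccur ⟨litsPattern Λ, S.cstr⟩ false a) ∨ IsReplacement l ls := by
  cases h with
  | prop_split S Λ a h₁ h₂ h₃ h₄ => exact Or.inl ⟨S, Λ, a, rfl, rfl, h₁, h₂, h₃, h₄⟩
  | constraint_split C Λ K o c π h =>
    refine Or.inr ⟨C, Λ, K, _, rfl, ?_, fun ρ hρ => ?_⟩
    · simp only [List.forall_mem_cons]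
      exact ⟨⟨_, _, rfl, replacement_nonempty Λ o π h⟩, ⟨_, _, rfl, replacement_empty Λ o π⟩,
        List.forall_mem_nil _⟩
    · by_cases hc : ∃ i, c.Holds (scons i ρ)
      · exact ⟨_, List.mem_cons_self, hρ, hc⟩
      · exact ⟨_, List.mem_cons_of_mem _ List.mem_cons_self, hρ, not_exists.1 hc⟩
  | rewriting C Λ K π π' h =>
    refine Or.inr ⟨C, Λ, K, π, rfl, ?_, fun ρ hρ => ⟨_, List.mem_cons_self, hρ⟩⟩
    simp only [List.forall_mem_cons]
    exact ⟨⟨C, π', rfl, h.replacement⟩, List.forall_mem_nil _⟩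
  | intervalise C Λ K o δ c π r k l e₁ e₂ hr hk hl hδ =>
    refine Or.inr ⟨C, Λ, K, _, rfl, ?_, fun ρ hρ => ?_⟩
    · simp only [List.forall_mem_cons]
      refine ⟨⟨_, _, rfl, replacement_interval Λ o π hr hδ ?_ fun ρ i h h' => ?_⟩,
        ⟨_, _, rfl, replacement_interval Λ o π hr (k := l) (l := k) (e₁ := e₂)
          (e₂ := e₁) (hδ.trans ?_) ?_ fun ρ i h h' => ?_⟩,
        List.forall_mem_nil _⟩
      · simp only [Constraint.fv, LinExpr.vars_nsmul hk, LinExpr.vars_nsmul hl]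
        exact subset_rfl
      · simp only [Constraint.Holds, LinExpr.eval_nsmul] at h
        exact Cmp.holds_of_interval hr hk hl h h'
      · rw [Multiset.pair_comm]
      · simp only [Constraint.fv, LinExpr.vars_nsmul hk, LinExpr.vars_nsmul hl]
        exact (Set.union_comm _ _).subset
      · simp only [Constraint.Holds, LinExpr.eval_nsmul] at h
        exact Cmp.holds_of_not_interval hr hk hl h h'
    · by_cases hc : (Constraint.cmp r (l • e₁) (k • e₂)).Holds ρ
      · exact ⟨_, List.mem_cons_self, hρ, hc⟩
      · exact ⟨_, List.mem_cons_of_mem _ List.mem_cons_self, hρ, hc⟩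

theorem Extension.nodeInv {l : Label P} {ls : List (Label P)} (h : Extension l ls) {S₀ : Schema P}
    (hl : NodeInv S₀ l) : ∀ l' ∈ ls, NodeInv S₀ l' := by
  classical
  rcases h.cases_replacement with ⟨S, Λ, a, rfl, rfl, ha, -⟩ | ⟨C, Λ, K, π, rfl, h, -⟩
  · simp only [List.forall_mem_cons]
    refine ⟨nodeInv_insert hl ha fun L hL => ?_, nodeInv_insert hl ha fun L hL => ?_,
      List.forall_mem_nil _⟩
    all_goals exact (Finset.mem_insert.1 hL).imp_left fun h => by rw [h]
  · intro l' hl'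
    obtain ⟨C', π', rfl, h⟩ := h l' hl'
    exact h.nodeInv hl

/-- Every model of the premise of an extension rule is a model of a conclusion, of smaller
measure. -/
theorem Extension.exists_model {l : Label P} {ls : List (Label P)} (h : Extension l ls)
    {ρ : ℕ → ℤ} {I : GroundAtom P → Prop} (hm : l.full.IsModel ρ I) (hfin : l.sch.pat.FinDom ρ) :
    ∃ l' ∈ ls, l'.full.IsModel ρ I ∧ l'.measure ρ < l.measure ρ := by
  classical
  rcases h.cases_replacement with ⟨S, Λ, a, rfl, rfl, -, h₁, h₂, h₃⟩ | ⟨C, Λ, K, π, rfl, h, h'⟩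
  · have hm' := (Label.isModel_full _ _ _).1 hm
    have hlt (b : Bool) : Label.measure ⟨S, insert (b, a) Λ⟩ ρ < Label.measure ⟨S, Λ⟩ ρ :=
      measure_insert_lt hm.1 hfin h₁ h₂ h₃ (Finset.subset_insert _ _)
        ⟨_, Finset.mem_insert_self _ _, rfl⟩
    have hmod (b : Bool) (hb : Literal.Holds I (b, a) ρ) :
        (Label.full ⟨S, insert (b, a) Λ⟩).IsModel ρ I := by
      rw [Label.isModel_full]
      exact ⟨hm'.1, hm'.2.1, Finset.forall_mem_insert _ _ _ |>.2 ⟨hb, hm'.2.2⟩⟩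
    by_cases ha : I (a.eval ρ)
    · exact ⟨_, List.mem_cons_self, hmod true ha, hlt true⟩
    · exact ⟨_, List.mem_cons_of_mem _ List.mem_cons_self, hmod false ha, hlt false⟩
  · obtain ⟨l', hl', hρ⟩ := h' ρ hm.1
    obtain ⟨C', π', rfl, h⟩ := h l' hl'
    exact ⟨_, hl', h.isModel hm hρ, h.measure_lt hfin hρ⟩

theorem Extension.length_le {l : Label P} {ls : List (Label P)} (h : Extension l ls) :
    ls.length ≤ 2 := by
  cases h <;> simp

/-! ### Tableaux -/

/-- What holds in the tableaux generated from the schema `S₀`. -/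
structure TableauInv (S₀ : Schema P) (T : Tableau P) : Prop where
  node : ∀ ν l, T.label ν = some l → NodeInv S₀ l
  children : ∀ ν l, T.label ν = some l → T.IsLeaf ν ∨
    ∃ ls, Extension l ls ∧ ∀ l' ∈ ls, ∃ b, T.label (b :: ν) = some l'
  parent : ∀ b ν l, T.label (b :: ν) = some l → T.label ν ≠ none
  looped : ∀ ν ∈ T.looped, ∃ l μ m, T.label ν = some l ∧ T.label μ = some m ∧
    l.full.LoopsOn m.full

theorem tableauInv_single {S : Schema P} (hS : S.WellFormed) :
    TableauInv S (Tableau.single S) where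
  node := by
    rintro (_ | ⟨b, ν⟩) l h
    · obtain rfl := Option.some.inj h
      refine ⟨subset_rfl, fun _ h => h, fun ρ _ => hS.1.finDom ρ, fun _ => ?_⟩
      rintro n ((hn | hn) | hn)
      · exact Or.inl hn
      · obtain ⟨L, hL, -⟩ := (fv_litsPattern _).1 hn
        exact absurd hL (Finset.notMem_empty L)
      · exact Or.inr hn
    · cases h
  children := by
    rintro (_ | ⟨b, ν⟩) l h
    · exact Or.inl ⟨rfl, fun _ => rfl⟩
    · cases h
  parent _ _ _ h := by cases h
  looped _ h := h.elim

theorem extend_label_of_some {T : Tableau P} {ν μ : List Bool} {ls : List (Label P)} {l : Label P}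
    (hν : T.IsLeaf ν) (h : T.label μ = some l) : (T.extend ν ls).label μ = some l := by
  cases μ with
  | nil => exact h
  | cons b μ =>
    have hne : μ ≠ ν := by
      rintro rfl
      rw [hν.2 b] at h
      cases h
    simp only [Tableau.extend, if_neg hne]
    exact h

theorem extend_label_child (T : Tableau P) (ν : List Bool) (ls : List (Label P)) (b : Bool) :
    (T.extend ν ls).label (b :: ν) = ls[b.toNat]? := by
  simp [Tableau.extend]

theorem exists_child {ls : List (Label P)} (hls : ls.length ≤ 2) {l : Label P} (hl : l ∈ ls) :
    ∃ b : Bool, ls[b.toNat]? = some l := by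
  obtain ⟨i, hi, rfl⟩ := List.mem_iff_getElem.1 hl
  obtain rfl | rfl : i = 0 ∨ i = 1 := by omega
  · exact ⟨false, List.getElem?_eq_getElem hi⟩
  · exact ⟨true, List.getElem?_eq_getElem hi⟩

theorem StepAt.label_of_some {T T' : Tableau P} {ν μ : List Bool} {l : Label P}
    (h : T.StepAt ν T') (hl : T.label μ = some l) : T'.label μ = some l := by
  cases h with
  | extension _ _ hleaf _ _ _ => exact extend_label_of_some hleaf hl
  | looping => exact hl

theorem TableauInv.step {S₀ : Schema P} {T T' : Tableau P} {ν : List Bool} (hT : TableauInv S₀ T)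
    (h : T.StepAt ν T') : TableauInv S₀ T' := by
  have hmono {μ l} := StepAt.label_of_some (μ := μ) (l := l) h
  cases h with
  | extension l ls hleaf hloop hl hext =>
    have hcases (μ : List Bool) (m : Label P) (hm : (T.extend ν ls).label μ = some m) :
        T.label μ = some m ∨ ∃ b, μ = b :: ν ∧ m ∈ ls := by
      cases μ with
      | nil => exact Or.inl hm
      | cons b μ =>
        by_cases hμ : μ = ν
        · subst hμ
          rw [extend_label_child] at hm
          exact Or.inr ⟨b, rfl, List.mem_of_getElem? hm⟩
        · simp only [Tableau.extend, if_neg hμ] at hm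
          exact Or.inl hm
    refine ⟨fun μ m hm => ?_, fun μ m hm => ?_, fun b μ m hm => ?_, fun μ hμ => ?_⟩
    · rcases hcases μ m hm with hm | ⟨-, -, hm⟩
      · exact hT.node μ m hm
      · exact hext.nodeInv (hT.node ν l hl) m hm
    · by_cases hμ : μ = ν
      · subst hμ
        rw [hmono hl] at hm
        obtain rfl := Option.some.inj hm
        refine Or.inr ⟨ls, hext, fun l' hl' => ?_⟩
        obtain ⟨b, hb⟩ := exists_child hext.length_le hl'
        exact ⟨b, (extend_label_child ..).trans hb⟩
      · have hlabel (b : Bool) : (T.extend ν ls).label (b :: μ) = T.label (b :: μ) := by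
          simp only [Tableau.extend, if_neg hμ]
        rcases hcases μ m hm with hm' | ⟨b, rfl, -⟩
        · simp only [hlabel, Tableau.IsLeaf, hm]
          have h := hT.children μ m hm'
          simp only [Tableau.IsLeaf, hm'] at h
          exact h
        · refine Or.inl ⟨by rw [hm]; rfl, fun b' => ?_⟩
          rw [hlabel]
          -- A label below a new node would have existed before the step, although its parent did
          -- not.
          by_contra hne
          obtain ⟨m', hm'⟩ := Option.ne_none_iff_exists'.1 hne
          exact hT.parent _ _ _ hm' (hleaf.2 b)
    · have hμ : T.label μ ≠ none := by
        rcases hcases _ m hm with hm | ⟨b', h, -⟩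
        · exact hT.parent b μ m hm
        · rw [(List.cons.inj h).2, hl]
          exact Option.some_ne_none l
      obtain ⟨m', hm'⟩ := Option.ne_none_iff_exists'.1 hμ
      rw [hmono hm']
      exact Option.some_ne_none m'
    · obtain ⟨m, μ', m', hm, hm', h⟩ := hT.looped μ hμ
      exact ⟨m, μ', m', hmono hm, hmono hm', h⟩
  | looping μ l m hleaf hloop hl hm h =>
    refine ⟨hT.node, hT.children, hT.parent, fun μ' hμ' => ?_⟩
    rcases hμ' with rfl | hμ'
    · exact ⟨l, μ, m, hl, hm, h⟩
    · exact hT.looped μ' hμ'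

/-! ### Looping and the size of environments -/

/-- The size of an environment on the finite set `s` of parameters. -/
def envSize (s : Finset ℕ) (ρ : ℕ → ℤ) : ℕ := ∑ n ∈ s, (ρ n).toNat

theorem LinExpr.vars_finite (e : LinExpr) : e.vars.Finite :=
  e.2.support.finite_toSet.subset fun n hn => by simpa [vars] using hn

theorem Constraint.fv_finite (c : Constraint) : c.fv.Finite := by
  induction c with
  | tru => exact Set.finite_empty
  | cmp r e f => exact e.vars_finite.union f.vars_finite
  | neg c ih => exact ih
  | and c₁ c₂ ih₁ ih₂ | or c₁ c₂ ih₁ ih₂ => exact ih₁.union ih₂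
  | ex c ih | all c ih => exact ih.preimage (add_left_injective 1).injOn

/-- If the constraint of a well-formed schema is satisfiable, then it contains all parameters. -/
theorem Schema.WellFormed.params_subset {S : Schema P} (hS : S.WellFormed)
    (h : S.cstr.Satisfiable) : S.params ⊆ S.cstr.fv := by
  obtain ⟨ρ, hρ⟩ := h
  intro n hn
  by_contra hfv
  -- A parameter that is not free in the constraint could be set to `-1` without falsifying it,
  -- against nonnegativity.
  have h := hS.2 (Function.update ρ n (-1)) ((S.cstr.holds_congr fun m hm => ?_).1 hρ) n hn
  · rw [Function.update_self] at h
    omega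
  · rw [Function.update_of_ne]
    rintro rfl
    exact hfv hm

/-- The sum runs over the free variables of the root constraint. They are parameters of every node,
so no summand grows; conversely the parameter that decreases is among them. Its new value is
nonnegative, so the drop survives `Int.toNat`. -/
theorem envSize_lt {S₀ : Schema P} (hS₀ : S₀.WellFormed) {l m : Label P} (hl : NodeInv S₀ l)
    (hm : NodeInv S₀ m) (hloop : l.full.LoopsOn m.full) {ρ : ℕ → ℤ} {I : GroundAtom P → Prop}
    (h : l.full.IsModel ρ I) : ∃ ρ' I', m.full.IsModel ρ' I' ∧
      envSize S₀.cstr.fv_finite.toFinset ρ' < envSize S₀.cstr.fv_finite.toFinset ρ := by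
  obtain ⟨-, hloop⟩ := hloop
  obtain ⟨ρ', I', h', n, hn, hlt, hle⟩ := hloop ρ I h
  refine ⟨ρ', I', h', Finset.sum_lt_sum (fun k hk => ?_) ⟨n, ?_, ?_⟩⟩
  · rw [Set.Finite.mem_toFinset] at hk
    refine Int.toNat_le_toNat ?_
    by_cases hkn : k = n
    · exact hkn ▸ hlt.le
    · exact hle k (Or.inr (hl.fv_mono hk)) hkn
  · rw [Set.Finite.mem_toFinset]
    exact hS₀.params_subset ⟨ρ, hl.entails ρ h.1⟩ (hl.params ⟨ρ, h.1⟩ hn)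
  · have h₀ := hS₀.2 ρ' (hm.entails ρ' h'.1) n (hl.params ⟨ρ, h.1⟩ hn)
    omega

/-! ### Fair derivations -/

theorem TableauInv.steps {S₀ : Schema P} {T T' : Tableau P} (hT : TableauInv S₀ T)
    (h : Relation.ReflTransGen Tableau.Step T T') : TableauInv S₀ T' := by
  induction h with
  | refl => exact hT
  | tail _ h ih =>
    obtain ⟨ν, h⟩ := h
    exact ih.step h

theorem IsDerivation.tableauInv {N : ℕ∞} {T : ℕ → Tableau P} (hder : IsDerivation N T)
    {S₀ : Schema P} (h : TableauInv S₀ (T 0)) {i : ℕ} (hi : (i : ℕ∞) ≤ N) :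
    TableauInv S₀ (T i) := by
  induction i with
  | zero => exact h
  | succ i ih =>
    obtain ⟨ν, hν⟩ := hder i hi
    exact (ih ((Nat.cast_le.2 i.le_succ).trans hi)).step hν

theorem IsDerivation.label_of_some {N : ℕ∞} {T : ℕ → Tableau P} (hder : IsDerivation N T)
    {i j : ℕ} (hij : i ≤ j) (hj : (j : ℕ∞) ≤ N) {ν : List Bool} {l : Label P}
    (h : (T i).label ν = some l) : (T j).label ν = some l := by
  induction j, hij using Nat.le_induction with
  | base => exact h
  | succ j _ ih =>
    obtain ⟨μ, hμ⟩ := hder j hj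
    exact StepAt.label_of_some hμ (ih ((Nat.cast_le.2 j.le_succ).trans hj))

/-- In a derivation in which no leaf that is not closed waits forever, no node has a model. -/
theorem not_isModel_of_fair {N : ℕ∞} {T : ℕ → Tableau P} (hder : IsDerivation N T)
    {S₀ : Schema P} (hS₀ : S₀.WellFormed) (hT : TableauInv S₀ (T 0))
    (hfair : ∀ i : ℕ, (i : ℕ∞) ≤ N → ∀ ν, (T i).IsLeaf ν → ¬ (T i).IsClosed ν →
      ∃ j : ℕ, i ≤ j ∧ ((j + 1 : ℕ) : ℕ∞) ≤ N ∧ (T j).StepAt ν (T (j + 1)))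
    {i : ℕ} (hi : (i : ℕ∞) ≤ N) {ν : List Bool} {l : Label P} (hl : (T i).label ν = some l)
    {ρ : ℕ → ℤ} {I : GroundAtom P → Prop} : ¬ l.full.IsModel ρ I := by
  induction hs : envSize S₀.cstr.fv_finite.toFinset ρ using Nat.strong_induction_on
    generalizing i ν l ρ I with
  | h s ihs =>
    -- The outer induction hypothesis is needed only for looping. It allows any node at any stage,
    -- since the looping target need not be on the branch being followed.
    have hloop {i : ℕ} {ν μ l m} (hi : (i : ℕ∞) ≤ N) (hl : (T i).label ν = some l)
        (hm : (T i).label μ = some m) (h : l.full.LoopsOn m.full) : ¬ l.full.IsModel ρ I := by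
      intro hmod
      have hinv := hder.tableauInv hT hi
      obtain ⟨ρ', I', h', hlt⟩ := envSize_lt hS₀ (hinv.node ν l hl) (hinv.node μ m hm) h hmod
      exact ihs _ (hs ▸ hlt) hi hm rfl h'
    clear ihs
    -- From here on `ρ` and `I` are fixed, while the stage and the node vary.
    induction hm : l.measure ρ using WellFoundedLT.induction generalizing i ν l with
    | ind x ihx =>
      subst hm
      intro hmod
      have hinv := hder.tableauInv hT hi
      have hfin := (hinv.node ν l hl).finDom ρ hmod.1
      rcases hinv.children ν l hl with hleaf | ⟨ls, hext, hls⟩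
      · have hclosed : ¬ (T i).IsClosed ν := by
          rintro (h | ⟨l', hl', h⟩)
          · obtain ⟨l', μ, m, hl', hm, h⟩ := hinv.looped ν h
            obtain rfl := Option.some.inj (hl.symm.trans hl')
            exact hloop hi hl hm h hmod
          · obtain rfl := Option.some.inj (hl.symm.trans hl')
            rcases h with h | h
            · have hbot := hmod.2.1
              rw [h] at hbot
              exact hbot
            · exact h ⟨ρ, hmod.1⟩
        -- The rule may be applied only at a later stage, but labels never change, so the node still
        -- has the same model then.
        obtain ⟨j, hij, hj, hstep⟩ := hfair i hi ν hleaf hclosed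
        have hj' : (j : ℕ∞) ≤ N := (Nat.cast_le.2 j.le_succ).trans hj
        have hlj := hder.label_of_some hij hj' hl
        generalize hT' : T (j + 1) = T' at hstep
        cases hstep with
        | extension l' ls hleaf' _ hl' hext =>
          obtain rfl := Option.some.inj (hlj.symm.trans hl')
          obtain ⟨m, hm, hmod', hlt⟩ := hext.exists_model hmod hfin
          obtain ⟨b, hb⟩ := exists_child hext.length_le hm
          refine ihx _ hlt hj (ν := b :: ν) ?_ rfl hmod'
          rw [hT', extend_label_child, hb]
        | looping μ l' m _ _ hl' hm h =>
          obtain rfl := Option.some.inj (hlj.symm.trans hl')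
          exact hloop hj' hlj hm h hmod
      · obtain ⟨m, hm, hmod', hlt⟩ := hext.exists_model hmod hfin
        obtain ⟨b, hb⟩ := hls m hm
        exact ihx _ hlt hi hb rfl hmod'

end SchDP

theorem mainTheorem2 {P : ℕ → Type*} (N : ℕ∞) (T : ℕ → SchDP.Tableau P)
    (hgen : (T 0).Generated) (hsat : (T 0).Satisfiable)
    (hder : SchDP.IsDerivation N T) (hfair : SchDP.IsFair N T) :
    ∃ k : ℕ, (k : ℕ∞) ≤ N ∧
      ∃ ν, (T k).IsLeaf ν ∧ (T k).Irreducible ν ∧ ¬ (T k).IsClosed ν := by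
  rcases hfair with hfair | hfair
  · exact hfair
  · obtain ⟨S₀, hS₀, hsteps⟩ := hgen
    obtain ⟨ν, l, -, hl, ρ, I, hmod⟩ := hsat
    exact absurd hmod (SchDP.not_isModel_of_fair hder hS₀
      ((SchDP.tableauInv_single hS₀).steps hsteps) hfair (by simp) hl)
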